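/- Let $M$ be a smooth finite-dimensional manifold without boundary and let $k\ge 1$. Let $T^kM$ be the $k$-th order tangent bundle, whose points are the $k$-jets $\mathbf t^k\gamma(t)$ of smooth curves. Local coordinates $(x^a)$ on a manifold induce adapted coordinates $x^{a,(\alpha)}$, $0\le\alpha\le k$, the derivatives of order $\alpha$ along the curve; for iterated functors $T^{n_1}\cdots T^{n_r}$ one writes $x^{a,(\epsilon_1,\dots,\epsilon_r)}$. **Canonical maps.** Let $\kappa_k:T^kTM\to TT^kM$ be the canonical flip, $x^{a,(\alpha,\epsilon)}\mapsto x^{a,(\epsilon,\alpha)}$, and let $\langle\cdot,\cdot\rangle_{T^k\tau}$ be the complete lift of the pairing of $T^*M$ and $TM$, a pairing of $T^kT^*M$ and $T^kTM$ over $T^kM$; in coordinates it is $\sum_a\sum_{\alpha}\binom k\alpha p_a^{(\alpha)}\dot x^{a,(k-\alpha)}$. Let $\varepsilon_k:T^*T^kM\to T^kT^*M$ be the isomorphism dual to $\kappa_k$, $\langle\Psi,\kappa_k(X)\rangle=\langle\varepsilon_k(\Psi),X\rangle_{T^k\tau}$; in coordinates $p_a^{(\alpha)}=\binom k\alpha^{-1}p_{a,(k-\alpha)}$.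 Write $T^{(k)}=T\cdots T$ ($k$ times). Let $\langle\cdot,\cdot\rangle_{T^{(k)}\tau}$ be the $k$-fold tangent lift of the pairing of $T^*M$ and $TM$. For $Y\in T^{(k)}T^*M$ lying over $v^k\in T^kM\subset T^{(k)}M$, let $P_k(Y)\in T^kT^*M$ be the element over $v^k$ with $\langle P_k(Y),\xi\rangle_{T^k\tau}=\langle Y,\xi\rangle_{T^{(k)}\tau}$ for all $\xi\in T^kTM$ over $v^k$. For $\Phi\in T^kT^kT^*M$ lying over an element of $T^{2k}M\subset T^kT^kM$, let $\Phi^{(j,k-j)}\in T^jT^{k-j}T^*M\subset T^{(k)}T^*M$ be its projections. They all lie over the same element $v^k\in T^kM$, and so can be added. Let $\Upsilon_k(\Phi)\in T^*M$ be the covector such that $$\langle\Upsilon_k(\Phi),\xi_0\rangle=\Big\langle\sum_{j=0}^k(-1)^j\tbinom kj\Phi^{(j,k-j)},\,\xi\Big\rangle_{T^{(k)}\tau}\quad\text{for all }\xi\in T^kTM\text{ over }v^k,$$ where $\xi_0\in TM$ is the projection of $\xi$ (the right-hand side depends only on $\xi_0$). For every $k\ge 0$ let $$\upsilon_k(\Phi)=P_k\Big(\sum_{j=0}^k(-1)^j\tbinom{k+1}{j+1}\Phi^{(j,k-j)}\Big)\in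 T^kT^*M .$$ **Variational problem.** Let $L:T^kM\to\mathbb R$ be smooth, let $S\subset T^{k-1}M\times T^{k-1}M$ be a submanifold (embedded or injectively immersed), let $t_0<t_1$, and let $\gamma:[t_0,t_1]\to M$ be smooth. A smooth vector field $\delta\gamma$ along $\gamma$ generates the variations $\delta\mathbf t^m\gamma=\kappa_m(\mathbf t^m\delta\gamma)$, $m\ge 0$. The curve $\gamma$ is a *solution* if $(\mathbf t^{k-1}\gamma(t_0),\mathbf t^{k-1}\gamma(t_1))\in S$ and $$\int_{t_0}^{t_1}\langle dL(\mathbf t^k\gamma(t)),\delta\mathbf t^k\gamma(t)\rangle\,dt=0$$ for every smooth $\delta\gamma$ with $(\delta\mathbf t^{k-1}\gamma(t_0),\delta\mathbf t^{k-1}\gamma(t_1))\in TS$. Let $\Lambda_L=\varepsilon_k\circ dL:T^kM\to T^kT^*M$, let $\lambda_L:T^kM\to T^{k-1}T^*M$ be its composition with the projection $T^kT^*M\to T^{k-1}T^*M$, and define the force and the momentum along $\gamma$ by $$F_{L,\gamma}(t)=\Upsilon_k\big(\mathbf t^k\Lambda_L(\mathbf t^k\gamma(t))\big)\in T^*M,\qquad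 M_{L,\gamma}(t)=\upsilon_{k-1}\big(\mathbf t^{k-1}\lambda_L(\mathbf t^k\gamma(t))\big)\in T^{k-1}T^*M .$$ **Theorem.** The curve $\gamma$ is a solution if and only if both of the following hold: 1. (Euler–Lagrange equation) $F_{L,\gamma}(t)=0$ for all $t\in[t_0,t_1]$; 2. (transversality) the pair $\big(-\varepsilon_{k-1}^{-1}(M_{L,\gamma}(t_0)),\ \varepsilon_{k-1}^{-1}(M_{L,\gamma}(t_1))\big)\in T^*T^{k-1}M\times T^*T^{k-1}M$ lies over a point of $S$ and annihilates the tangent space of $S$ at this point. -/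

import Mathlib

open Set Filter Topology Manifold Bundle ContDiff MeasureTheory

noncomputable section

namespace HigherVelocity

/-! ### `k`-jets at `0` of curves in a normed space -/

section Jets

variable {E : Type*} [NormedAddCommGroup E] [NormedSpace ℝ E]
  {E' : Type*} [NormedAddCommGroup E'] [NormedSpace ℝ E']
  {E'' : Type*} [NormedAddCommGroup E''] [NormedSpace ℝ E'']

/-- The polynomial curve `t ↦ ∑ α, (t ^ α / α!) u_α`, whose derivatives at `0` are `u_0, …, u_k`. -/
def jetPoly {k : ℕ} (u : Fin (k + 1) → E) (t : ℝ) : E :=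
  ∑ α : Fin (k + 1), (t ^ (α : ℕ) / ((α : ℕ).factorial : ℝ)) • u α

/-- The action of a map `f` on `k`-jets at `0`: if `u_0, …, u_k` are the derivatives at `0` of a
curve `c`, then `jetMap f u` is the list of the derivatives at `0` of `f ∘ c`. -/
def jetMap {k : ℕ} (f : E → E') (u : Fin (k + 1) → E) : Fin (k + 1) → E' :=
  fun α => iteratedDeriv (α : ℕ) (fun t => f (jetPoly u t)) 0

lemma contDiff_jetPoly {k : ℕ} :
    ContDiff ℝ ∞ (fun p : (Fin (k + 1) → E) × ℝ => jetPoly p.1 p.2) := by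
  unfold jetPoly
  fun_prop

lemma contDiff_jetPoly_right {k : ℕ} (u : Fin (k + 1) → E) : ContDiff ℝ ∞ (jetPoly u) := by
  unfold jetPoly
  fun_prop

@[simp] lemma jetPoly_zero {k : ℕ} (u : Fin (k + 1) → E) : jetPoly u 0 = u 0 := by
  unfold jetPoly
  rw [Finset.sum_eq_single 0]
  · simp
  · intro b _ hb
    have : (b : ℕ) ≠ 0 := fun h => hb (Fin.ext h)
    simp [this]
  · simp

lemma jetMap_zero {k : ℕ} (f : E → E') (u : Fin (k + 1) → E) : jetMap f u 0 = f (u 0) := by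
  simp [jetMap]

lemma iteratedDeriv_jetPoly {k : ℕ} (u : Fin (k + 1) → E) (α : Fin (k + 1)) :
    iteratedDeriv (α : ℕ) (jetPoly u) 0 = u α := by
  have h : jetPoly u = fun t => ∑ β : Fin (k + 1),
      (t ^ (β : ℕ) / ((β : ℕ).factorial : ℝ)) • u β := rfl
  have h1 : ∀ β : Fin (k + 1), iteratedDeriv (α : ℕ)
      (fun t : ℝ => (t ^ (β : ℕ) / ((β : ℕ).factorial : ℝ)) • u β) 0
        = if α = β then u β else 0 := by
    intro β
    have h2 : (fun t : ℝ => (t ^ (β : ℕ) / ((β : ℕ).factorial : ℝ)) • u β)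
        = fun t : ℝ => (t ^ (β : ℕ)) • ((((β : ℕ).factorial : ℝ))⁻¹ • u β) := by
      funext t; rw [smul_smul, div_eq_mul_inv]
    rw [h2, iteratedDeriv_smul_const (by fun_prop), iteratedDeriv_fun_pow_zero]
    have h3 : ((β : ℕ).factorial : ℝ) ≠ 0 := by positivity
    by_cases hab : α = β
    · subst hab; simp [smul_smul, h3]
    · simp [hab, Fin.val_inj]
  rw [h, iteratedDeriv_fun_sum (fun β _ => by fun_prop)]
  simp [h1]

lemma jetMap_congr {k : ℕ} {f g : E → E'} {u : Fin (k + 1) → E} (h : f =ᶠ[𝓝 (u 0)] g) :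
    jetMap f u = jetMap g u := by
  funext α
  refine Filter.EventuallyEq.iteratedDeriv_eq _ ?_
  have : Tendsto (jetPoly u) (𝓝 0) (𝓝 (u 0)) := by
    simpa using (contDiff_jetPoly_right u).continuous.tendsto 0
  exact this.eventually h

lemma jetMap_id {k : ℕ} (u : Fin (k + 1) → E) : jetMap id u = u := by
  funext α
  exact iteratedDeriv_jetPoly u α

/-- The `k`-jet of `f ∘ c` depends only on the `k`-jet of `c`. -/
lemma iteratedDeriv_comp_congr {f : E → E'} {c d : ℝ → E} {n : ℕ} {t : ℝ}
    (hc : ContDiffAt ℝ ∞ c t) (hd : ContDiffAt ℝ ∞ d t) (hf : ContDiffAt ℝ ∞ f (c t))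
    (h : ∀ i ≤ n, iteratedDeriv i c t = iteratedDeriv i d t) :
    iteratedDeriv n (f ∘ c) t = iteratedDeriv n (f ∘ d) t := by
  have h0 : c t = d t := by simpa using h 0 (Nat.zero_le _)
  have hF : ∀ i ≤ n, iteratedFDeriv ℝ i c t = iteratedFDeriv ℝ i d t := by
    intro i hi
    rw [iteratedFDeriv_eq_equiv_comp, iteratedFDeriv_eq_equiv_comp]
    simp [h i hi]
  have hn : ((n : ℕ) : WithTop ℕ∞) ≤ ∞ := by exact_mod_cast le_top
  rw [iteratedDeriv_eq_iteratedFDeriv, iteratedDeriv_eq_iteratedFDeriv,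
    iteratedFDeriv_comp hf hc hn, iteratedFDeriv_comp (h0 ▸ hf) hd hn]
  congr 1
  rw [h0]
  unfold FormalMultilinearSeries.taylorComp
  refine Finset.sum_congr rfl fun P _ => ?_
  refine ContinuousMultilinearMap.ext fun v => ?_
  simp only [FormalMultilinearSeries.compAlongOrderedFinpartition_apply]
  congr 1
  funext m
  have := hF (P.partSize m) (P.partSize_le m)
  simp only [OrderedFinpartition.applyOrderedFinpartition]
  exact DFunLike.congr_fun this _

lemma jetMap_comp {k : ℕ} {f : E → E'} {g : E' → E''} {u : Fin (k + 1) → E}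
    (hf : ContDiffAt ℝ ∞ f (u 0)) (hg : ContDiffAt ℝ ∞ g (f (u 0))) :
    jetMap g (jetMap f u) = jetMap (g ∘ f) u := by
  have hfc : ContDiffAt ℝ ∞ (fun t => f (jetPoly u t)) 0 := by
    have := (contDiff_jetPoly_right u).contDiffAt (x := 0)
    exact ContDiffAt.comp (0 : ℝ) (by simpa using hf) this
  funext α
  refine iteratedDeriv_comp_congr (f := g) (contDiff_jetPoly_right _).contDiffAt hfc
    (by simpa [jetMap_zero] using hg) fun i hi => ?_
  exact iteratedDeriv_jetPoly (jetMap f u) ⟨i, lt_of_le_of_lt hi α.2⟩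

lemma contDiffAt_iteratedDeriv_param {X : Type*} [NormedAddCommGroup X] [NormedSpace ℝ X]
    {G : X × ℝ → E} {p : X × ℝ} (hG : ContDiffAt ℝ ∞ G p) (n : ℕ) :
    ContDiffAt ℝ ∞ (fun q : X × ℝ => iteratedDeriv n (fun t => G (q.1, t)) q.2) p := by
  induction n with
  | zero => simpa using hG
  | succ n ih =>
    set K : X × ℝ → E := fun q => iteratedDeriv n (fun t => G (q.1, t)) q.2 with hK
    have h1 : ∀ᶠ q in 𝓝 p, DifferentiableAt ℝ K q := by
      have h1 : ContDiffAt ℝ 1 K p := ih.of_le (by exact_mod_cast le_top)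
      filter_upwards [h1.eventually (by simp)] with q hq using hq.differentiableAt (by simp)
    have h2 : ContDiffAt ℝ ∞ (fun q => fderiv ℝ K q (0, 1)) p :=
      (ih.fderiv_right (m := ∞) (by simp)).clm_apply contDiffAt_const
    refine h2.congr_of_eventuallyEq ?_
    filter_upwards [h1] with q hq
    rw [iteratedDeriv_succ]
    have h3 : HasDerivAt (fun t : ℝ => (q.1, t)) ((0 : X), (1 : ℝ)) q.2 :=
      (hasDerivAt_const _ _).prodMk (hasDerivAt_id _)
    exact (HasFDerivAt.comp_hasDerivAt q.2 (f := fun t : ℝ => (q.1, t)) hq.hasFDerivAt h3).deriv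

lemma contDiffAt_jetMap {k : ℕ} {f : E → E'} {u : Fin (k + 1) → E}
    (hf : ContDiffAt ℝ ∞ f (u 0)) : ContDiffAt ℝ ∞ (jetMap f (k := k)) u := by
  rw [contDiffAt_pi]
  intro α
  have hG : ContDiffAt ℝ ∞ (fun p : (Fin (k + 1) → E) × ℝ => f (jetPoly p.1 p.2)) (u, 0) :=
    ContDiffAt.comp (u, (0 : ℝ)) (by simpa using hf) contDiff_jetPoly.contDiffAt
  have := contDiffAt_iteratedDeriv_param hG α
  exact this.comp u (f := fun w => (w, (0 : ℝ))) (contDiffAt_id.prodMk contDiffAt_const)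

end Jets

/-! ### Higher tangent bundles -/

section Velocities

variable {E : Type*} [NormedAddCommGroup E] [NormedSpace ℝ E] {H : Type*} [TopologicalSpace H]

/-- The `k`-th order tangent bundle `T^k M`: a `k`-velocity consists of its base point `x` and of
the derivatives of orders `1, …, k`, read in the preferred chart at `x`, of a curve that represents
it (a tangent vector is treated in the same way in `TangentSpace`). -/
@[ext] structure Velocity (I : ModelWithCorners ℝ E H) (k : ℕ) (M : Type*) where
  /-- the base point -/
  base : M
  /-- the derivatives of orders `1, …, k` in the preferred chart at the base point -/
  tail : Fin k → E

variable {I : ModelWithCorners ℝ E H} {k : ℕ} {M : Type*} [TopologicalSpace M] [ChartedSpace H M]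

/-- The adapted coordinates `x^{(0)}, …, x^{(k)}` of a `k`-velocity that come from the preferred
chart of `M` at its base point. -/
def Velocity.coord (v : Velocity I k M) : Fin (k + 1) → E :=
  Fin.cons (extChartAt I v.base v.base) v.tail

@[simp] lemma Velocity.coord_zero (v : Velocity I k M) :
    v.coord 0 = extChartAt I v.base v.base := rfl

@[simp] lemma Velocity.coord_succ (v : Velocity I k M) (i : Fin k) :
    v.coord i.succ = v.tail i := rfl

/-- The `k`-velocity `j^k γ(t)` of a curve `γ` at time `t`. -/
def prolong (I : ModelWithCorners ℝ E H) (k : ℕ) (γ : ℝ → M) (t : ℝ) : Velocity I k M where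
  base := γ t
  tail i := iteratedDeriv (i + 1) (fun s => extChartAt I (γ t) (γ s)) t

/-- The projection `T^{k+1} M → T^k M`. -/
def Velocity.truncate (v : Velocity I (k + 1) M) : Velocity I k M where
  base := v.base
  tail i := v.tail i.castSucc

variable [I.Boundaryless] [IsManifold I ∞ M]

lemma contDiffAt_coordChange {x y : M} {u : E} (hu : u ∈ (extChartAt I x).target)
    (hy : (extChartAt I x).symm u ∈ (extChartAt I y).source) :
    ContDiffAt ℝ ∞ (extChartAt I y ∘ (extChartAt I x).symm) u := by
  have h := contDiffWithinAt_ext_coord_change (I := I) (n := ∞) y x (y := u)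
    (by simpa [PartialEquiv.trans_source] using And.intro hu hy)
  rwa [I.range_eq_univ, contDiffWithinAt_univ] at h

/-- Coordinate changes of `k`-jets compose. -/
lemma jetMap_coordChange {x y z : M} {u : Fin (k + 1) → E}
    (hu : u 0 ∈ (extChartAt I x).target)
    (hy : (extChartAt I x).symm (u 0) ∈ (extChartAt I y).source)
    (hz : (extChartAt I x).symm (u 0) ∈ (extChartAt I z).source) :
    jetMap (extChartAt I z ∘ (extChartAt I y).symm)
        (jetMap (extChartAt I y ∘ (extChartAt I x).symm) u)
      = jetMap (extChartAt I z ∘ (extChartAt I x).symm) u := by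
  have e : (extChartAt I y).symm (extChartAt I y ((extChartAt I x).symm (u 0)))
      = (extChartAt I x).symm (u 0) := (extChartAt I y).left_inv hy
  rw [jetMap_comp (contDiffAt_coordChange hu hy)
    (contDiffAt_coordChange ((extChartAt I y).map_source hy) (by rwa [Function.comp_apply, e]))]
  apply jetMap_congr
  have hc : ContinuousAt (extChartAt I x).symm (u 0) := continuousAt_extChartAt_symm'' hu
  filter_upwards [hc.preimage_mem_nhds ((isOpen_extChartAt_source (I := I) y).mem_nhds hy)]
    with w hw
  simp only [Function.comp_apply]
  rw [(extChartAt I y).left_inv hw]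

lemma jetMap_coordChange_self {x : M} {u : Fin (k + 1) → E}
    (hu : u 0 ∈ (extChartAt I x).target) :
    jetMap (extChartAt I x ∘ (extChartAt I x).symm) u = u := by
  conv_rhs => rw [← jetMap_id u]
  apply jetMap_congr
  filter_upwards [(isOpen_extChartAt_target (I := I) x).mem_nhds hu] with w hw
  exact (extChartAt I x).right_inv hw

variable (I k) in
/-- The adapted chart of `T^k M` induced by the preferred chart of `M` at `x`: it sends `j^k γ(0)`
to the derivatives of orders `0, …, k` at `0` of `γ` read in the chart at `x`. -/
def velocityChart (x : M) : PartialEquiv (Velocity I k M) (Fin (k + 1) → E) where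
  toFun v := jetMap (extChartAt I x ∘ (extChartAt I v.base).symm) v.coord
  invFun u :=
    { base := (extChartAt I x).symm (u 0)
      tail := fun i => jetMap
        (extChartAt I ((extChartAt I x).symm (u 0)) ∘ (extChartAt I x).symm) u i.succ }
  source := {v | v.base ∈ (extChartAt I x).source}
  target := {u | u 0 ∈ (extChartAt I x).target}
  map_source' v hv := by
    simp only [mem_ofPred_eq, jetMap_zero, Function.comp_apply, Velocity.coord_zero,
      extChartAt_to_inv] at hv ⊢
    exact (extChartAt I x).map_source hv
  map_target' u hu := (extChartAt I x).map_target hu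
  left_inv' v hv := by
    have h0 : jetMap (extChartAt I x ∘ (extChartAt I v.base).symm) v.coord 0
        = extChartAt I x v.base := by
      simp [jetMap_zero]
    have h1 : (extChartAt I x).symm (extChartAt I x v.base) = v.base :=
      (extChartAt I x).left_inv hv
    ext i
    · simp only [h0, h1]
    · simp only [h0, h1]
      rw [jetMap_coordChange (by simp) (by simpa using hv) (by simp),
        jetMap_coordChange_self (by simp)]
      rfl
  right_inv' u hu := by
    have hs : (⟨(extChartAt I x).symm (u 0), fun i => jetMap
        (extChartAt I ((extChartAt I x).symm (u 0)) ∘ (extChartAt I x).symm) u i.succ⟩ :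
        Velocity I k M).coord
        = jetMap (extChartAt I ((extChartAt I x).symm (u 0)) ∘ (extChartAt I x).symm) u := by
      funext i
      refine Fin.cases ?_ (fun i => ?_) i
      · simp [jetMap_zero]
      · simp
    simp only [hs]
    rw [jetMap_coordChange hu (by simp) ((extChartAt I x).map_target hu),
      jetMap_coordChange_self hu]

/-- The adapted chart at `x` sends `j^k γ(t)` to the derivatives of orders `0, …, k` at `t` of `γ`
read in the chart at `x`. -/
lemma velocityChart_prolong {γ : ℝ → M} {t : ℝ} (hγ : ContMDiffAt 𝓘(ℝ, ℝ) I ∞ γ t) {x : M}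
    (hx : γ t ∈ (extChartAt I x).source) (α : Fin (k + 1)) :
    velocityChart I k x (prolong I k γ t) α
      = iteratedDeriv α (fun s => extChartAt I x (γ s)) t := by
  have hc : ContDiffAt ℝ ∞ (fun s => extChartAt I (γ t) (γ s)) t := by
    have := (contMDiffAt_iff.1 hγ).2
    simp only [extChartAt_model_space_eq_id, PartialEquiv.refl_symm, PartialEquiv.refl_coe,
      modelWithCornersSelf_coe, range_id, contDiffWithinAt_univ] at this
    exact this
  have hc' : ContDiffAt ℝ ∞ (fun s => extChartAt I (γ t) (γ (t + s))) 0 :=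
    ContDiffAt.comp (0 : ℝ) (f := fun s => t + s) (by simpa using hc) (by fun_prop)
  have hs : ∀ (n : ℕ) (f : ℝ → E), iteratedDeriv n (fun s => f (t + s)) 0
      = iteratedDeriv n f t := fun n f => by
    rw [iteratedDeriv_comp_const_add]; simp
  rw [← hs]
  have hcont : ∀ᶠ s in 𝓝 (0 : ℝ), γ (t + s) ∈ (extChartAt I (γ t)).source := by
    have h1 : ContinuousAt (fun s => γ (t + s)) 0 :=
      ContinuousAt.comp (f := fun s : ℝ => t + s) (by simpa using hγ.continuousAt) (by fun_prop)
    exact h1.preimage_mem_nhds ((isOpen_extChartAt_source (I := I) (γ t)).mem_nhds (by simp))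
  have he : (fun s => extChartAt I x (γ (t + s))) =ᶠ[𝓝 0]
      (extChartAt I x ∘ (extChartAt I (γ t)).symm) ∘ fun s => extChartAt I (γ t) (γ (t + s)) := by
    filter_upwards [hcont] with s hs
    simp only [Function.comp_apply]
    rw [(extChartAt I (γ t)).left_inv hs]
  rw [he.iteratedDeriv_eq]
  refine iteratedDeriv_comp_congr (f := extChartAt I x ∘ (extChartAt I (γ t)).symm)
    (c := jetPoly (prolong I k γ t).coord) (contDiff_jetPoly_right _).contDiffAt hc' ?_ fun i hi => ?_
  · rw [jetPoly_zero]
    exact contDiffAt_coordChange (by simp [prolong]) (by simpa [prolong] using hx)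
  · have h := iteratedDeriv_jetPoly (prolong I k γ t).coord ⟨i, lt_of_le_of_lt hi α.2⟩
    rw [h, hs i fun s => extChartAt I (γ t) (γ s)]
    cases i with
    | zero => simp [prolong]
    | succ i => rfl

lemma velocityChart_trans_source (x y : M) :
    ((velocityChart I k x).symm.trans (velocityChart I k y)).source
      = {u | u 0 ∈ ((extChartAt I x).symm.trans (extChartAt I y)).source} := by
  ext u
  simp [PartialEquiv.trans_source, velocityChart]

lemma velocityChart_trans_apply (x y : M) {u : Fin (k + 1) → E}
    (hu : u ∈ ((velocityChart I k x).symm.trans (velocityChart I k y)).source) :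
    (velocityChart I k x).symm.trans (velocityChart I k y) u
      = jetMap (extChartAt I y ∘ (extChartAt I x).symm) u := by
  rw [velocityChart_trans_source] at hu
  simp only [PartialEquiv.trans_source, PartialEquiv.symm_source, mem_ofPred_eq, mem_inter_iff,
    mem_preimage] at hu
  have hs : ((velocityChart I k x).symm u).coord
      = jetMap (extChartAt I ((extChartAt I x).symm (u 0)) ∘ (extChartAt I x).symm) u := by
    funext i
    refine Fin.cases ?_ (fun i => ?_) i
    · simp [jetMap_zero, velocityChart]
    · simp [velocityChart]
  change jetMap (extChartAt I y ∘ (extChartAt I ((extChartAt I x).symm (u 0))).symm)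
    ((velocityChart I k x).symm u).coord = _
  rw [hs, jetMap_coordChange hu.1 (by simp) hu.2]

lemma isOpen_velocityChart_trans_source (x y : M) :
    IsOpen ((velocityChart I k x).symm.trans (velocityChart I k y)).source := by
  rw [velocityChart_trans_source]
  have h : IsOpen ((extChartAt I x).symm.trans (extChartAt I y)).source := by
    rw [PartialEquiv.trans_source]
    exact (continuousOn_extChartAt_symm x).isOpen_inter_preimage (isOpen_extChartAt_target x)
      (isOpen_extChartAt_source y)
  exact h.preimage (continuous_apply 0)

lemma contDiffOn_velocityChart_trans (x y : M) :
    ContDiffOn ℝ ∞ ((velocityChart I k x).symm.trans (velocityChart I k y))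
      ((velocityChart I k x).symm.trans (velocityChart I k y)).source := by
  refine ContDiffOn.congr (f := jetMap (extChartAt I y ∘ (extChartAt I x).symm)) ?_
    fun u hu => velocityChart_trans_apply x y hu
  intro u hu
  rw [velocityChart_trans_source] at hu
  exact (contDiffAt_jetMap (contDiffAt_coordChange hu.1 hu.2)).contDiffWithinAt

variable (I k M) in
/-- The atlas of adapted charts of `T^k M`. -/
def velocityCore : ChartedSpaceCore (Fin (k + 1) → E) (Velocity I k M) where
  atlas := range (velocityChart I k)
  chartAt v := velocityChart I k v.base
  mem_chart_source v := mem_extChartAt_source (I := I) v.base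
  chart_mem_atlas v := mem_range_self v.base
  open_source := by
    rintro _ _ ⟨x, rfl⟩ ⟨y, rfl⟩
    exact isOpen_velocityChart_trans_source x y
  continuousOn_toFun := by
    rintro _ _ ⟨x, rfl⟩ ⟨y, rfl⟩
    exact (contDiffOn_velocityChart_trans x y).continuousOn

instance : TopologicalSpace (Velocity I k M) := (velocityCore I k M).toTopologicalSpace

instance : ChartedSpace (Fin (k + 1) → E) (Velocity I k M) := (velocityCore I k M).toChartedSpace

instance : IsManifold 𝓘(ℝ, Fin (k + 1) → E) ∞ (Velocity I k M) := by
  refine isManifold_of_contDiffOn _ _ _ fun e e' he he' => ?_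
  obtain ⟨_, ⟨x, rfl⟩, rfl⟩ := mem_iUnion₂.1 he
  obtain ⟨_, ⟨y, rfl⟩, rfl⟩ := mem_iUnion₂.1 he'
  simp only [modelWithCornersSelf_coe, modelWithCornersSelf_coe_symm, Function.comp_id,
    Function.id_comp, preimage_id, range_id, inter_univ]
  exact contDiffOn_velocityChart_trans x y

/-- In its preferred chart, a `k`-velocity has the coordinates `Velocity.coord`. -/
lemma extChartAt_velocity_self (v : Velocity I k M) :
    extChartAt 𝓘(ℝ, Fin (k + 1) → E) v v = v.coord :=
  jetMap_coordChange_self (I := I) (x := v.base) (u := v.coord) (by simp)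


end Velocities

/-! ### Velocities in a vector bundle -/

section Bundles

variable {E : Type*} [NormedAddCommGroup E] [NormedSpace ℝ E] {H : Type*} [TopologicalSpace H]
  {I : ModelWithCorners ℝ E H} {k : ℕ} {M : Type*} [TopologicalSpace M] [ChartedSpace H M]
  {F : Type*} [NormedAddCommGroup F] [NormedSpace ℝ F] {V : M → Type*}
  [TopologicalSpace (TotalSpace F V)] [∀ x, TopologicalSpace (V x)] [FiberBundle F V]

/-- For a vector bundle `σ : V → M`, the projection `T^k σ : T^k V → T^k M`. -/
def Velocity.mapProj (A : Velocity (I.prod 𝓘(ℝ, F)) k (TotalSpace F V)) : Velocity I k M where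
  base := A.base.proj
  tail i := (A.tail i).1

/-- The linear coordinates `y^{(0)}, …, y^{(k)}` of `A ∈ T^k V` on the fibre of `T^k σ`, that come
from the preferred trivialization at the base point. -/
def Velocity.fib (A : Velocity (I.prod 𝓘(ℝ, F)) k (TotalSpace F V)) : Fin (k + 1) → F :=
  fun α => (A.coord α).2

lemma Velocity.fib_zero (A : Velocity (I.prod 𝓘(ℝ, F)) k (TotalSpace F V)) :
    A.fib 0 = (trivializationAt F V A.base.proj A.base).2 := by
  simp only [Velocity.fib, Velocity.coord_zero, FiberBundle.extChartAt]
  rfl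

variable [∀ x, Zero (V x)]

/-- The element of `T^k V` over `v ∈ T^k M` with the linear coordinates `y^{(0)}, …, y^{(k)}`. -/
def Velocity.ofFib (v : Velocity I k M) (y : Fin (k + 1) → F) :
    Velocity (I.prod 𝓘(ℝ, F)) k (TotalSpace F V) where
  base := ⟨v.base, (trivializationAt F V v.base).symm v.base (y 0)⟩
  tail i := (v.tail i, y i.succ)

@[simp] lemma Velocity.mapProj_ofFib (v : Velocity I k M) (y : Fin (k + 1) → F) :
    (Velocity.ofFib v y : Velocity (I.prod 𝓘(ℝ, F)) k (TotalSpace F V)).mapProj = v := rfl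

@[simp] lemma Velocity.fib_ofFib (v : Velocity I k M) (y : Fin (k + 1) → F) :
    (Velocity.ofFib v y : Velocity (I.prod 𝓘(ℝ, F)) k (TotalSpace F V)).fib = y := by
  funext α
  refine Fin.cases ?_ (fun i => rfl) α
  rw [Velocity.fib_zero]
  simp only [Velocity.ofFib]
  rw [(trivializationAt F V v.base).apply_mk_symm (mem_baseSet_trivializationAt F V v.base)]

@[simp] lemma Velocity.ofFib_mapProj_fib (A : Velocity (I.prod 𝓘(ℝ, F)) k (TotalSpace F V)) :
    Velocity.ofFib A.mapProj A.fib = A := by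
  refine Velocity.ext ?_ ?_
  · simp only [Velocity.ofFib, Velocity.fib_zero, Velocity.mapProj]
    rw [TotalSpace.ext_iff]
    exact ⟨rfl, heq_of_eq ((trivializationAt F V A.base.proj).symm_proj_apply A.base
      (mem_baseSet_trivializationAt F V A.base.proj))⟩
  · rfl

end Bundles

/-! ### The canonical flip, its dual, and the lifted pairings -/

section Flip

variable {E : Type*} [NormedAddCommGroup E] [NormedSpace ℝ E] {H : Type*} [TopologicalSpace H]

/-- The cotangent bundle `T* M`. -/
abbrev CotangentBundle (I : ModelWithCorners ℝ E H) (M : Type*) [TopologicalSpace M]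
    [ChartedSpace H M] : Type _ :=
  TotalSpace (E →L[ℝ] ℝ) (fun x : M => TangentSpace I x →L[ℝ] ℝ)

variable {I : ModelWithCorners ℝ E H} [I.Boundaryless] {k : ℕ} {M : Type*} [TopologicalSpace M]
  [ChartedSpace H M] [IsManifold I ∞ M]

/-- The canonical flip `κ_k : T^k T M → T T^k M`, which sends `x^{(α, ε)}` to `x^{(ε, α)}` in
adapted coordinates. -/
def canonicalFlip (A : Velocity I.tangent k (TangentBundle I M)) :
    TangentBundle 𝓘(ℝ, Fin (k + 1) → E) (Velocity I k M) :=
  ⟨A.mapProj, A.fib⟩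

/-- The pairing `⟨A, X⟩` of `A ∈ T^k T* M` and `X ∈ T^k T M` over the same `k`-velocity, that is
the complete lift of the pairing of `T* M` and `T M`. -/
def pairing (A : Velocity (I.prod 𝓘(ℝ, E →L[ℝ] ℝ)) k (CotangentBundle I M))
    (X : Velocity I.tangent k (TangentBundle I M)) : ℝ :=
  ∑ α : Fin (k + 1), (k.choose α : ℝ) * A.fib α (X.fib α.rev)

lemma choose_ne_zero (α : Fin (k + 1)) : (k.choose α : ℝ) ≠ 0 := by
  exact_mod_cast (Nat.choose_pos (Nat.lt_succ_iff.1 α.2)).ne'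

lemma choose_rev (α : Fin (k + 1)) : k.choose α.rev = k.choose α := by
  rw [Fin.val_rev, Nat.add_sub_add_right, Nat.choose_symm (Nat.lt_succ_iff.1 α.2)]

/-- The map `ε_k` in coordinates: `p^{(α)} = (k choose α)⁻¹ p_{(k - α)}`. -/
def lower (p : (Fin (k + 1) → E) →L[ℝ] ℝ) (α : Fin (k + 1)) : E →L[ℝ] ℝ :=
  (k.choose α : ℝ)⁻¹ • (p ∘L ContinuousLinearMap.single ℝ (fun _ => E) α.rev)

/-- The inverse of `ε_k` in coordinates: `p_{(α)} = (k choose α) p^{(k - α)}`. -/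
def raise (y : Fin (k + 1) → E →L[ℝ] ℝ) : (Fin (k + 1) → E) →L[ℝ] ℝ :=
  ∑ α : Fin (k + 1), (k.choose α : ℝ) • (y α.rev ∘L ContinuousLinearMap.proj α)

lemma raise_lower (p : (Fin (k + 1) → E) →L[ℝ] ℝ) : raise (lower p) = p := by
  refine ContinuousLinearMap.ext fun w => ?_
  simp only [raise, lower, _root_.sum_apply, _root_.smul_apply, choose_rev,
    ContinuousLinearMap.comp_apply, ContinuousLinearMap.proj_apply, Fin.rev_rev, smul_eq_mul,
    ContinuousLinearMap.single_apply, mul_inv_cancel_left₀ (choose_ne_zero _)]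
  rw [← map_sum, Finset.univ_sum_single]

lemma lower_raise (y : Fin (k + 1) → E →L[ℝ] ℝ) : lower (raise y) = y := by
  funext α
  refine ContinuousLinearMap.ext fun w => ?_
  simp only [raise, lower, _root_.smul_apply, ContinuousLinearMap.comp_apply, smul_eq_mul,
    _root_.sum_apply, ContinuousLinearMap.single_apply]
  rw [Finset.sum_eq_single α.rev]
  · simp only [Pi.single_eq_same, ContinuousLinearMap.proj_apply, Fin.rev_rev, choose_rev,
      inv_mul_cancel_left₀ (choose_ne_zero _)]
  · intro β _ hβ
    simp [hβ]
  · simp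

/-- The dual `ε_k : T* T^k M → T^k T* M` of the canonical flip, with its inverse. -/
def dualFlip : CotangentBundle 𝓘(ℝ, Fin (k + 1) → E) (Velocity I k M) ≃
    Velocity (I.prod 𝓘(ℝ, E →L[ℝ] ℝ)) k (CotangentBundle I M) where
  toFun Ψ := Velocity.ofFib Ψ.proj (lower Ψ.2)
  invFun A := ⟨A.mapProj, raise A.fib⟩
  left_inv Ψ := by
    rw [TotalSpace.ext_iff]
    refine ⟨Velocity.mapProj_ofFib _ _, heq_of_eq ?_⟩
    simp only [Velocity.fib_ofFib]
    exact raise_lower _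
  right_inv A := by
    change Velocity.ofFib A.mapProj (lower (raise A.fib)) = A
    rw [lower_raise, Velocity.ofFib_mapProj_fib]

/-- The map `ε_k` is dual to `κ_k`: `⟨Ψ, κ_k X⟩ = ⟨ε_k Ψ, X⟩` if `Ψ` and `X` lie over the same
`k`-velocity. -/
lemma apply_canonicalFlip (X : Velocity I.tangent k (TangentBundle I M))
    (p : TangentSpace 𝓘(ℝ, Fin (k + 1) → E) (canonicalFlip X).proj →L[ℝ] ℝ) :
    p (canonicalFlip X).2 = pairing (dualFlip ⟨(canonicalFlip X).proj, p⟩) X := by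
  have h : ∀ q : (Fin (k + 1) → E) →L[ℝ] ℝ, q X.fib = ∑ α : Fin (k + 1), (k.choose α : ℝ) *
      lower q α (X.fib α.rev) := fun q => by
    simp only [lower, _root_.smul_apply, ContinuousLinearMap.comp_apply, smul_eq_mul,
      ContinuousLinearMap.single_apply, mul_inv_cancel_left₀ (choose_ne_zero _)]
    have := Equiv.sum_comp Fin.revPerm (fun α => q (Pi.single α (X.fib α)))
    simp only [Fin.revPerm_apply] at this
    rw [this, ← map_sum, Finset.univ_sum_single]
  have h2 : (dualFlip ⟨(canonicalFlip X).proj, p⟩).fib = lower p := Velocity.fib_ofFib _ _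
  rw [pairing, h2]
  exact h p

end Flip

/-! ### Semi-holonomic vectors and geometric integration by parts on `T* M` -/

section Parts

variable {E : Type*} [NormedAddCommGroup E] [NormedSpace ℝ E] {H : Type*} [TopologicalSpace H]

/-- Semi-holonomic vectors of the `k`-fold iterated tangent bundle of `τ* : T* M → M`, i.e. elements
of `T ⋯ T T* M` that lie over a `k`-velocity `v ∈ T^k M ⊂ T ⋯ T M`. They are given by `v` and by the
linear coordinates `y^{(ε)}`, `ε ∈ {0, 1}^k`, on the fibre over `v`, in the adapted coordinates that
come from the preferred chart at the base point. The multi-index `ε` is encoded as the set of the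
positions at which it is `1`, so `|ε|` is the cardinality of this set. -/
structure SemiHolonomic (I : ModelWithCorners ℝ E H) (k : ℕ) (M : Type*) where
  /-- the `k`-velocity below the vector -/
  base : Velocity I k M
  /-- the linear coordinates `y^{(ε)}` -/
  coord : Finset (Fin k) → E →L[ℝ] ℝ

variable {I : ModelWithCorners ℝ E H} [I.Boundaryless] {k : ℕ} {M : Type*} [TopologicalSpace M]
  [ChartedSpace H M] [IsManifold I ∞ M]

lemma card_lt_succ (s : Finset (Fin k)) : s.card < k + 1 :=
  Nat.lt_succ_of_le (by simpa using s.card_le_univ)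

/-- The pairing `∑_ε y^{(ε)} ξ^{((1, …, 1) - ε)}` of the `k`-fold iterated tangent bundles of `T* M`
and `T M` (the `k`-fold tangent lift of the pairing of `T* M` and `T M`), between a semi-holonomic
vector and an element `ξ` of `T^k T M ⊂ T ⋯ T T M`. -/
def iterPairing (Y : SemiHolonomic I k M) (ξ : Velocity I.tangent k (TangentBundle I M)) : ℝ :=
  ∑ ε : Finset (Fin k), Y.coord ε (ξ.fib ⟨εᶜ.card, card_lt_succ _⟩)

/-- The projection `P_k` of semi-holonomic vectors onto `T^k T* M`: averaging of the coordinates of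
the same total degree. -/
def holProj (Y : SemiHolonomic I k M) :
    Velocity (I.prod 𝓘(ℝ, E →L[ℝ] ℝ)) k (CotangentBundle I M) :=
  Velocity.ofFib Y.base fun α => (k.choose α : ℝ)⁻¹ •
    ∑ ε ∈ Finset.powersetCard α Finset.univ, Y.coord ε

/-- The projection `P_k` is determined by `⟨P_k Y, ξ⟩ = ⟨Y, ξ⟩`. -/
lemma pairing_holProj (Y : SemiHolonomic I k M)
    (ξ : Velocity I.tangent k (TangentBundle I M)) :
    pairing (holProj Y) ξ = iterPairing Y ξ := by
  simp only [pairing, holProj, Velocity.fib_ofFib, _root_.smul_apply, smul_eq_mul,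
    _root_.sum_apply, mul_inv_cancel_left₀ (choose_ne_zero _), iterPairing]
  rw [← Finset.sum_fiberwise (s := Finset.univ)
    (g := fun ε : Finset (Fin k) => (⟨ε.card, card_lt_succ ε⟩ : Fin (k + 1)))]
  refine Finset.sum_congr rfl fun α _ => ?_
  have : Finset.powersetCard (α : ℕ) (Finset.univ : Finset (Fin k)) = Finset.univ.filter
      fun ε : Finset (Fin k) => (⟨ε.card, card_lt_succ ε⟩ : Fin (k + 1)) = α := by
    ext ε
    simp [Finset.mem_powersetCard, Fin.ext_iff]
  rw [this]
  refine Finset.sum_congr rfl fun ε hε => ?_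
  simp only [Finset.mem_filter, Finset.mem_univ, true_and] at hε
  congr 2
  subst hε
  ext
  simp [Fin.val_rev, Finset.card_compl]

/-- The bundle `T^k T^k T* M`. -/
abbrev BiVelocity (I : ModelWithCorners ℝ E H) [I.Boundaryless] (k : ℕ) (M : Type*)
    [TopologicalSpace M] [ChartedSpace H M] [IsManifold I ∞ M] : Type _ :=
  Velocity 𝓘(ℝ, Fin (k + 1) → E × (E →L[ℝ] ℝ)) k
    (Velocity (I.prod 𝓘(ℝ, E →L[ℝ] ℝ)) k (CotangentBundle I M))

/-- The linear coordinates `y^{(α, β)}` on `T^k T^k T* M` (with `α` for the outer functor `T^k`). -/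
def BiVelocity.fib (Φ : BiVelocity I k M) (α β : Fin (k + 1)) : E →L[ℝ] ℝ :=
  (Φ.coord α β).2

/-- For `Φ ∈ T^k T^k T* M` that lies over an element of `T^{2k} M ⊂ T^k T^k M`, the projection
`Φ^{(j, k - j)} ∈ T^j T^{k - j} T* M` as a vector of the `k`-fold iterated tangent bundle, over the
`k`-velocity below `Φ`: the coordinate `y^{(ε)}` is `y^{(ε_1 + ⋯ + ε_j, ε_{j + 1} + ⋯ + ε_k)}`. -/
def BiVelocity.iter (Φ : BiVelocity I k M) (j : ℕ) : SemiHolonomic I k M where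
  base := Velocity.mapProj Φ.base
  coord ε := Φ.fib ⟨(ε.filter fun i : Fin k => (i : ℕ) < j).card, card_lt_succ _⟩
    ⟨(ε.filter fun i : Fin k => ¬ (i : ℕ) < j).card, card_lt_succ _⟩

/-- The linear combination `∑_j a_j Φ^{(j, k - j)}` in the `k`-fold iterated tangent bundle. -/
def BiVelocity.comb (Φ : BiVelocity I k M) (a : ℕ → ℝ) : SemiHolonomic I k M where
  base := Velocity.mapProj Φ.base
  coord ε := ∑ j ∈ Finset.range (k + 1), a j • (Φ.iter j).coord ε

/-- The vector `∑_j (-1)^j (k choose j) Φ^{(j, k - j)}`. -/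
def BiVelocity.tilde (Φ : BiVelocity I k M) : SemiHolonomic I k M :=
  Φ.comb fun j => (-1) ^ j * (k.choose j : ℝ)

/-- The map `Υ_k : T^k T^k T* M → T* M` (on vectors over `T^{2k} M`). The covector `Υ_k Φ` is defined
by `⟨Υ_k Φ, ξ_0⟩ = ⟨∑_j (-1)^j (k choose j) Φ^{(j, k - j)}, ξ⟩` for every `ξ ∈ T^k T M` over the
`k`-velocity below `Φ`, where `ξ_0` is the base point of `ξ`; so it is the coefficient of `ξ^{(0)}`
in the pairing, see `iterPairing_tilde`. -/
def upsilon (Φ : BiVelocity I k M) : CotangentBundle I M :=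
  ⟨Φ.base.base.proj, (trivializationAt (E →L[ℝ] ℝ) (fun x : M => TangentSpace I x →L[ℝ] ℝ)
    Φ.base.base.proj).symm Φ.base.base.proj (Φ.tilde.coord Finset.univ)⟩

/-- The map `υ_k : T^k T^k T* M → T^k T* M` (on vectors over `T^{2k} M`),
`Φ ↦ P_k (∑_j (-1)^j (k + 1 choose j + 1) Φ^{(j, k - j)})`. -/
def momenta (Φ : BiVelocity I k M) : Velocity (I.prod 𝓘(ℝ, E →L[ℝ] ℝ)) k (CotangentBundle I M) :=
  holProj (Φ.comb fun j => (-1) ^ j * ((k + 1).choose (j + 1) : ℝ))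

lemma sum_card_inter {k : ℕ} (A : Finset (Fin k)) (g : ℕ → ℕ → ℝ) :
    ∑ ε : Finset (Fin k), g (ε ∩ A).card (ε \ A).card
      = ∑ a ∈ Finset.range (A.card + 1), ∑ b ∈ Finset.range (k - A.card + 1),
        (A.card.choose a * (k - A.card).choose b : ℝ) * g a b := by
  have h1 : ∑ ε : Finset (Fin k), g (ε ∩ A).card (ε \ A).card
      = ∑ p ∈ A.powerset ×ˢ Aᶜ.powerset, g p.1.card p.2.card := by
    refine Finset.sum_bij' (fun ε _ => (ε ∩ A, ε \ A)) (fun p _ => p.1 ∪ p.2) ?_ ?_ ?_ ?_ ?_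
    · intro ε _
      simp only [Finset.mem_product, Finset.mem_powerset]
      refine ⟨Finset.inter_subset_right, fun i hi => ?_⟩
      simp_all
    · simp
    · intro ε _
      ext i
      simp only [Finset.mem_union, Finset.mem_inter, Finset.mem_sdiff]
      tauto
    · rintro ⟨s, t⟩ h
      simp only [Finset.mem_product, Finset.mem_powerset] at h
      have h3 : ∀ i ∈ t, i ∉ A := fun i hi => by simpa using h.2 hi
      have h4 : ∀ i ∈ s, i ∈ A := fun i hi => h.1 hi
      refine Prod.ext ?_ ?_ <;>
      · ext i
        have := h3 i
        have := h4 i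
        simp only [Finset.mem_union, Finset.mem_inter, Finset.mem_sdiff]
        tauto
    · intro ε _
      rfl
  rw [h1, Finset.sum_product]
  have h2 : Aᶜ.card = k - A.card := by simp [Finset.card_compl]
  have h5 : ∀ s : Finset (Fin k), ∑ t ∈ Aᶜ.powerset, g s.card t.card
      = ∑ b ∈ Finset.range (k - A.card + 1), ((k - A.card).choose b : ℝ) * g s.card b := fun s => by
    rw [Finset.sum_powerset_apply_card (fun b => g s.card b), h2]
    simp [nsmul_eq_mul]
  simp only [h5]
  rw [Finset.sum_powerset_apply_card (fun a => ∑ b ∈ Finset.range (k - A.card + 1),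
    ((k - A.card).choose b : ℝ) * g a b)]
  simp only [nsmul_eq_mul, Finset.mul_sum, mul_assoc]

lemma sum_alternating {k : ℕ} (g : ℕ → ℕ → ℝ) :
    ∑ j ∈ Finset.range (k + 1), ((-1) ^ j * (k.choose j : ℝ)) *
        ∑ ε : Finset (Fin k), g (ε.filter fun i : Fin k => (i : ℕ) < j).card
          (ε.filter fun i : Fin k => ¬ (i : ℕ) < j).card
      = ∑ j ∈ Finset.range (k + 1), ((-1) ^ j * (k.choose j : ℝ)) * g j (k - j) := by
  set h : ℕ → ℝ := fun m => ∑ a ∈ Finset.range (m + 1), ∑ b ∈ Finset.range (k - m + 1),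
        (m.choose a * (k - m).choose b : ℝ) * g a b with hh
  have h1 : ∀ j ∈ Finset.range (k + 1), ∑ ε : Finset (Fin k),
      g (ε.filter fun i : Fin k => (i : ℕ) < j).card (ε.filter fun i : Fin k => ¬ (i : ℕ) < j).card = h j := by
    intro j hj
    have hj' : j ≤ k := by simpa [Nat.lt_succ_iff] using hj
    set A : Finset (Fin k) := Finset.univ.filter fun i : Fin k => (i : ℕ) < j with hA
    have hc : A.card = j := by simp [hA, Fin.card_filter_val_lt, hj']
    have := sum_card_inter A g
    rw [hc] at this
    simp only [hh]
    rw [← this]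
    refine Finset.sum_congr rfl fun ε _ => ?_
    congr 2 <;> ext i <;> simp [hA]
  have h2 : ∀ f : ℕ → ℝ, ∑ j ∈ Finset.range (k + 1), ((-1) ^ j * (k.choose j : ℝ)) * f j
      = ∑ A : Finset (Fin k), (-1) ^ A.card * f A.card := by
    intro f
    rw [← Finset.powerset_univ, Finset.sum_powerset_apply_card (fun m => (-1) ^ m * f m)]
    simp only [Finset.card_univ, Fintype.card_fin, nsmul_eq_mul]
    exact Finset.sum_congr rfl fun j _ => by ring
  rw [Finset.sum_congr rfl fun j hj => by rw [h1 j hj], h2 h, h2 fun j => g j (k - j)]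
  simp only [hh, ← sum_card_inter]
  simp only [Finset.mul_sum]
  rw [Finset.sum_comm, Finset.sum_eq_single Finset.univ]
  · refine Finset.sum_congr rfl fun A _ => ?_
    simp [Finset.card_sdiff]
  · intro ε _ hε
    obtain ⟨i, hi⟩ : ∃ i, i ∉ ε := by
      by_contra! hcon
      exact hε (Finset.eq_univ_of_forall hcon)
    refine Finset.sum_involution (fun A _ => symmDiff A {i}) ?_ ?_ ?_ ?_
    · intro A _
      have e1 : ε ∩ symmDiff A {i} = ε ∩ A := by
        ext l
        by_cases hl : l = i
        · subst hl; simp [hi]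
        · simp [Finset.mem_symmDiff, hl]
      have e2 : ε \ symmDiff A {i} = ε \ A := by
        ext l
        by_cases hl : l = i
        · subst hl; simp [hi]
        · simp [Finset.mem_symmDiff, hl]
      have e3 : ((-1 : ℝ)) ^ (symmDiff A {i}).card = - (-1) ^ A.card := by
        by_cases hA : i ∈ A
        · have : symmDiff A {i} = A.erase i := by
            ext l
            by_cases hl : l = i
            · subst hl; simp [Finset.mem_symmDiff, hA]
            · simp [Finset.mem_symmDiff, hl]
          rw [this, ← Finset.card_erase_add_one hA, pow_succ]
          ring
        · have : symmDiff A {i} = insert i A := by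
            ext l
            by_cases hl : l = i
            · subst hl; simp [Finset.mem_symmDiff, hA]
            · simp [Finset.mem_symmDiff, hl]
          rw [this, Finset.card_insert_of_notMem hA, pow_succ]
          ring
      rw [e1, e2, e3]
      ring
    · intro A _ _ hcon
      have : i ∈ symmDiff A {i} ↔ i ∈ A := by rw [hcon]
      simp [Finset.mem_symmDiff] at this
    · simp
    · intro A _
      simp
  · simp

/-- The pairing of `∑_j (-1)^j (k choose j) Φ^{(j, k - j)}` with `ξ ∈ T^k T M` depends only on the
base point of `ξ`. -/
lemma iterPairing_tilde (Φ : BiVelocity I k M) (ξ : Velocity I.tangent k (TangentBundle I M)) :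
    iterPairing Φ.tilde ξ = Φ.tilde.coord Finset.univ (ξ.fib 0) := by
  set g : ℕ → ℕ → ℝ := fun a b => if h : a < k + 1 ∧ b < k + 1 then
    Φ.fib ⟨a, h.1⟩ ⟨b, h.2⟩ (ξ.fib ⟨k - (a + b), by omega⟩) else 0 with hg
  have h := sum_alternating (k := k) g
  have hL : iterPairing Φ.tilde ξ = ∑ j ∈ Finset.range (k + 1), ((-1) ^ j * (k.choose j : ℝ)) *
        ∑ ε : Finset (Fin k), g (ε.filter fun i : Fin k => (i : ℕ) < j).card
          (ε.filter fun i : Fin k => ¬ (i : ℕ) < j).card := by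
    simp only [iterPairing, BiVelocity.tilde, BiVelocity.comb, BiVelocity.iter,
      _root_.sum_apply, _root_.smul_apply, smul_eq_mul, Finset.mul_sum]
    rw [Finset.sum_comm]
    refine Finset.sum_congr rfl fun j _ => Finset.sum_congr rfl fun ε _ => ?_
    rw [hg]
    simp only [card_lt_succ, and_self, dite_true]
    congr 4
    rw [Finset.card_filter_add_card_filter_not, Finset.card_compl, Fintype.card_fin]
  rw [hL, h]
  simp only [BiVelocity.tilde, BiVelocity.comb, BiVelocity.iter,
      _root_.sum_apply, _root_.smul_apply, smul_eq_mul]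
  refine Finset.sum_congr rfl fun j hj => ?_
  have hj' : j ≤ k := by simpa [Nat.lt_succ_iff] using hj
  have c1 : ((Finset.univ : Finset (Fin k)).filter fun i : Fin k => (i : ℕ) < j).card = j := by
    simp [Fin.card_filter_val_lt, hj']
  have c2 : ((Finset.univ : Finset (Fin k)).filter fun i : Fin k => ¬ (i : ℕ) < j).card = k - j := by
    have := Finset.card_filter_add_card_filter_not (s := (Finset.univ : Finset (Fin k)))
      (fun i : Fin k => (i : ℕ) < j)
    rw [c1, Finset.card_univ, Fintype.card_fin] at this
    omega
  rw [hg]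
  have h3 : j < k + 1 ∧ k - j < k + 1 := by omega
  have h4 : k - (j + (k - j)) = 0 := by omega
  simp only [h3, and_self, dite_true, h4, c1, c2]
  rfl

end Parts

/-! ### The higher-order variational problem -/

section Variational

variable {E : Type*} [NormedAddCommGroup E] [NormedSpace ℝ E] {H : Type*} [TopologicalSpace H]
  {I : ModelWithCorners ℝ E H} [I.Boundaryless] {k : ℕ} {M : Type*} [TopologicalSpace M]
  [ChartedSpace H M] [IsManifold I ∞ M]

/-- The differential `dL : T^k M → T* T^k M` of a Lagrangian `L : T^k M → ℝ`. -/
def differential (L : Velocity I k M → ℝ) (v : Velocity I k M) :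
    CotangentBundle 𝓘(ℝ, Fin (k + 1) → E) (Velocity I k M) :=
  ⟨v, mfderiv 𝓘(ℝ, Fin (k + 1) → E) 𝓘(ℝ, ℝ) L v⟩

/-- The map `Λ_L = ε_k ∘ dL : T^k M → T^k T* M`. -/
def bigLambda (L : Velocity I k M → ℝ) (v : Velocity I k M) :
    Velocity (I.prod 𝓘(ℝ, E →L[ℝ] ℝ)) k (CotangentBundle I M) :=
  dualFlip (differential L v)

/-- The map `λ_L : T^{k+1} M → T^k T* M`, the composition of `Λ_L : T^{k+1} M → T^{k+1} T* M` with
the projection. -/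
def smallLambda (L : Velocity I (k + 1) M → ℝ) (v : Velocity I (k + 1) M) :
    Velocity (I.prod 𝓘(ℝ, E →L[ℝ] ℝ)) k (CotangentBundle I M) :=
  (bigLambda L v).truncate

/-- The force `F_{L,γ}(t) = Υ_k (j^k Λ_L (j^k γ)(t)) ∈ T* M`. -/
def force (L : Velocity I k M → ℝ) (γ : ℝ → M) (t : ℝ) : CotangentBundle I M :=
  upsilon (prolong 𝓘(ℝ, Fin (k + 1) → E × (E →L[ℝ] ℝ)) k (fun s => bigLambda L (prolong I k γ s)) t)

/-- The momentum `M_{L,γ}(t) = υ_k (j^k λ_L (j^{k+1} γ)(t)) ∈ T^k T* M` of a Lagrangian of order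
`k + 1`. -/
def momentum (L : Velocity I (k + 1) M → ℝ) (γ : ℝ → M) (t : ℝ) :
    Velocity (I.prod 𝓘(ℝ, E →L[ℝ] ℝ)) k (CotangentBundle I M) :=
  momenta (prolong 𝓘(ℝ, Fin (k + 1) → E × (E →L[ℝ] ℝ)) k
    (fun s => smallLambda L (prolong I (k + 1) γ s)) t)

/-- The variation `δj^k γ = κ_k (j^k δγ)` generated by a vector field `δγ` along `γ`; it is a curve
in `T T^k M` over `j^k γ`. -/
def variation (k : ℕ) (γ : ℝ → M) (δγ : (t : ℝ) → TangentSpace I (γ t)) (t : ℝ) :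
    TangentBundle 𝓘(ℝ, Fin (k + 1) → E) (Velocity I k M) :=
  canonicalFlip (prolong I.tangent k (fun s => (⟨γ s, δγ s⟩ : TangentBundle I M)) t)

/-- The differential `⟨dS_L(j^k γ), δj^k γ⟩ = ∫ ⟨dL(j^k γ(t)), δj^k γ(t)⟩ dt` of the action in the
direction of a variation. -/
def actionDifferential (L : Velocity I k M → ℝ) (t₀ t₁ : ℝ)
    (δ : ℝ → TangentBundle 𝓘(ℝ, Fin (k + 1) → E) (Velocity I k M)) : ℝ :=
  ∫ t in t₀..t₁, mfderiv 𝓘(ℝ, Fin (k + 1) → E) 𝓘(ℝ, ℝ) L (δ t).proj (δ t).2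

variable {E' : Type*} [NormedAddCommGroup E'] [NormedSpace ℝ E'] {H' : Type*} [TopologicalSpace H']
  {N : Type*} [TopologicalSpace N] [ChartedSpace H' N]

/-- For a submanifold `S ⊂ T^k M × T^k M` given by an injective immersion `i : N → T^k M × T^k M`,
the tangent bundle `T S` as a subset of `T T^k M × T T^k M`. -/
def tangentSet (J : ModelWithCorners ℝ E' H') (i : N → Velocity I k M × Velocity I k M) :
    Set (TangentBundle 𝓘(ℝ, Fin (k + 1) → E) (Velocity I k M) ×
      TangentBundle 𝓘(ℝ, Fin (k + 1) → E) (Velocity I k M)) :=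
  range fun ξ : TangentBundle J N => equivTangentBundleProd _ _ _ _
    (tangentMap J (𝓘(ℝ, Fin (k + 1) → E).prod 𝓘(ℝ, Fin (k + 1) → E)) i ξ)

/-- `γ : [t₀, t₁] → M` solves the variational problem of order `k + 1` given by the Lagrangian `L`
and the submanifold `S = i(N)` of admissible boundary values: its boundary values are admissible,
and the differential of the action vanishes on all variations that are tangent to `S` at the
boundary. -/
def IsSolution (J : ModelWithCorners ℝ E' H') (i : N → Velocity I k M × Velocity I k M)
    (L : Velocity I (k + 1) M → ℝ) (t₀ t₁ : ℝ) (γ : ℝ → M) : Prop :=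
  (prolong I k γ t₀, prolong I k γ t₁) ∈ range i ∧
  ∀ δγ : (t : ℝ) → TangentSpace I (γ t),
    (∀ t ∈ Icc t₀ t₁, ContMDiffAt 𝓘(ℝ, ℝ) I.tangent ∞
      (fun s => (⟨γ s, δγ s⟩ : TangentBundle I M)) t) →
    (variation k γ δγ t₀, variation k γ δγ t₁) ∈ tangentSet J i →
    actionDifferential L t₀ t₁ (variation (k + 1) γ δγ) = 0

/-- The pair of covectors `(a, b) ∈ T* T^k M × T* T^k M` lies over a point of `S = i(N)` and
annihilates the tangent space of `S` at this point. -/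
def Annihilates (J : ModelWithCorners ℝ E' H') (i : N → Velocity I k M × Velocity I k M)
    (a b : CotangentBundle 𝓘(ℝ, Fin (k + 1) → E) (Velocity I k M)) : Prop :=
  (a.proj, b.proj) ∈ range i ∧
  ∀ (v : TangentSpace 𝓘(ℝ, Fin (k + 1) → E) a.proj)
    (w : TangentSpace 𝓘(ℝ, Fin (k + 1) → E) b.proj),
    ((⟨a.proj, v⟩, ⟨b.proj, w⟩) : TangentBundle 𝓘(ℝ, Fin (k + 1) → E) (Velocity I k M) ×
      TangentBundle 𝓘(ℝ, Fin (k + 1) → E) (Velocity I k M)) ∈ tangentSet J i → a.2 v + b.2 w = 0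

/-- The covector `-a`. -/
def negCovector (a : CotangentBundle 𝓘(ℝ, Fin (k + 1) → E) (Velocity I k M)) :
    CotangentBundle 𝓘(ℝ, Fin (k + 1) → E) (Velocity I k M) :=
  ⟨a.proj, -a.2⟩

end Variational

end HigherVelocity

end

open HigherVelocity

set_option linter.unusedSectionVars false

noncomputable section

namespace HigherVelocity

section Calculus

variable {E : Type*} [NormedAddCommGroup E] [NormedSpace ℝ E]
  {F : Type*} [NormedAddCommGroup F] [NormedSpace ℝ F]
  {X : Type*} [NormedAddCommGroup X] [NormedSpace ℝ X]

lemma contDiffAt_iteratedDeriv {c : ℝ → F} {t : ℝ} (hc : ContDiffAt ℝ ∞ c t) (n : ℕ) :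
    ContDiffAt ℝ ∞ (iteratedDeriv n c) t :=
  (contDiffAt_iteratedDeriv_param (X := ℝ) (G := fun p : ℝ × ℝ => c p.2) (p := (0, t))
    (ContDiffAt.comp ((0 : ℝ), t) (g := c) hc contDiffAt_snd) n).comp t
    (f := fun s => ((0 : ℝ), s)) (contDiffAt_const.prodMk contDiffAt_id)

lemma iteratedDeriv_clm_comp (g : E →L[ℝ] F) {f : ℝ → E} {t : ℝ} {n : ℕ}
    (hf : ContDiffAt ℝ n f t) :
    iteratedDeriv n (fun s => g (f s)) t = g (iteratedDeriv n f t) := by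
  rw [iteratedDeriv_eq_iteratedFDeriv, iteratedDeriv_eq_iteratedFDeriv]
  exact congrArg (fun m => m fun _ => (1 : ℝ)) (g.iteratedFDeriv_comp_left hf le_rfl)

lemma iteratedDeriv_fst {f : ℝ → E × F} {t : ℝ} {n : ℕ} (hf : ContDiffAt ℝ n f t) :
    (iteratedDeriv n f t).1 = iteratedDeriv n (fun s => (f s).1) t :=
  (iteratedDeriv_clm_comp (ContinuousLinearMap.fst ℝ E F) hf).symm

lemma iteratedDeriv_snd {f : ℝ → E × F} {t : ℝ} {n : ℕ} (hf : ContDiffAt ℝ n f t) :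
    (iteratedDeriv n f t).2 = iteratedDeriv n (fun s => (f s).2) t :=
  (iteratedDeriv_clm_comp (ContinuousLinearMap.snd ℝ E F) hf).symm

lemma iteratedDeriv_apply {ι : Type*} [Fintype ι] {f : ℝ → ι → E} {t : ℝ} {n : ℕ}
    (hf : ContDiffAt ℝ n f t) (i : ι) :
    iteratedDeriv n f t i = iteratedDeriv n (fun s => f s i) t :=
  (iteratedDeriv_clm_comp (ContinuousLinearMap.proj (R := ℝ) (φ := fun _ : ι => E) i) hf).symm

/-- The Leibniz rule for the evaluation of a curve of linear maps on a curve of vectors. -/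
lemma iteratedDeriv_clm_apply {a : ℝ → E →L[ℝ] F} {ξ : ℝ → E} {t : ℝ} {n : ℕ}
    (ha : ContDiffAt ℝ n a t) (hξ : ContDiffAt ℝ n ξ t) :
    iteratedDeriv n (fun s => a s (ξ s)) t = ∑ i ∈ Finset.range (n + 1),
      (n.choose i : ℝ) • iteratedDeriv i a t (iteratedDeriv (n - i) ξ t) := by
  induction n generalizing a ξ with
  | zero => simp
  | succ n ih =>
    have hle : ((n : ℕ) : WithTop ℕ∞) ≤ ((n + 1 : ℕ) : WithTop ℕ∞) := by
      exact_mod_cast Nat.le_succ n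
    have h1 : (1 : WithTop ℕ∞) ≤ ((n + 1 : ℕ) : WithTop ℕ∞) := by
      exact_mod_cast Nat.succ_le_succ (Nat.zero_le n)
    have ha' : ContDiffAt ℝ n (deriv a) t := (ha.fderiv_right_succ (n := n)).clm_apply contDiffAt_const
    have hξ' : ContDiffAt ℝ n (deriv ξ) t :=
      (hξ.fderiv_right_succ (n := n)).clm_apply contDiffAt_const
    have hd : deriv (fun s => a s (ξ s)) =ᶠ[𝓝 t]
        (fun s => deriv a s (ξ s)) + fun s => a s (deriv ξ s) := by
      filter_upwards [(ha.of_le h1).eventually (by simp), (hξ.of_le h1).eventually (by simp)]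
        with s h2 h3
      exact ((h2.differentiableAt (by simp)).hasDerivAt.clm_apply
        (h3.differentiableAt (by simp)).hasDerivAt).deriv
    rw [iteratedDeriv_succ', hd.iteratedDeriv_eq, iteratedDeriv_add
      (ha'.clm_apply (hξ.of_le hle)) ((ha.of_le hle).clm_apply hξ'), ih ha' (hξ.of_le hle),
      ih (ha.of_le hle) hξ']
    simp only [← iteratedDeriv_succ']
    have h2 : ∑ i ∈ Finset.range (n + 1), (n.choose i : ℝ) •
        iteratedDeriv i a t (iteratedDeriv (n - i + 1) ξ t) = ∑ i ∈ Finset.range (n + 1 + 1),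
        (n.choose i : ℝ) • iteratedDeriv i a t (iteratedDeriv (n + 1 - i) ξ t) := by
      rw [Finset.sum_range_succ _ (n + 1), Nat.choose_succ_self, Nat.cast_zero, zero_smul, add_zero]
      refine Finset.sum_congr rfl fun i hi => ?_
      rw [Nat.sub_add_comm (Nat.lt_succ_iff.1 (Finset.mem_range.1 hi))]
    rw [h2, Finset.sum_range_succ' _ (n + 1), Finset.sum_range_succ' _ (n + 1), ← add_assoc,
      ← Finset.sum_add_distrib]
    simp [Nat.choose_succ_succ', add_smul]

/-- The `n`-th derivative of `f ∘ c` at a point depends only on the derivatives of orders at most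
`n` of `c`, for functions of class `C^n`. -/
lemma iteratedDeriv_comp_congr_of_contDiffAt {f : E → F} {c d : ℝ → E} {n : ℕ} {t : ℝ}
    (hc : ContDiffAt ℝ n c t) (hd : ContDiffAt ℝ n d t) (hf : ContDiffAt ℝ n f (c t))
    (h : ∀ i ≤ n, iteratedDeriv i c t = iteratedDeriv i d t) :
    iteratedDeriv n (f ∘ c) t = iteratedDeriv n (f ∘ d) t := by
  have h0 : c t = d t := by simpa using h 0 (Nat.zero_le _)
  have hF : ∀ i ≤ n, iteratedFDeriv ℝ i c t = iteratedFDeriv ℝ i d t := by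
    intro i hi
    rw [iteratedFDeriv_eq_equiv_comp, iteratedFDeriv_eq_equiv_comp]
    simp [h i hi]
  rw [iteratedDeriv_eq_iteratedFDeriv, iteratedDeriv_eq_iteratedFDeriv,
    iteratedFDeriv_comp hf hc le_rfl, iteratedFDeriv_comp (h0 ▸ hf) hd le_rfl]
  congr 1
  rw [h0]
  unfold FormalMultilinearSeries.taylorComp
  refine Finset.sum_congr rfl fun P _ => ?_
  refine ContinuousMultilinearMap.ext fun v => ?_
  simp only [FormalMultilinearSeries.compAlongOrderedFinpartition_apply]
  congr 1
  funext m
  have := hF (P.partSize m) (P.partSize_le m)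
  simp only [OrderedFinpartition.applyOrderedFinpartition]
  exact DFunLike.congr_fun this _

/-- Derivatives with respect to a parameter commute with those with respect to the time. -/
lemma fderiv_iteratedDeriv_param {G : X × ℝ → F} {p : X × ℝ}
    (hG : ∀ᶠ q in 𝓝 p, ContDiffAt ℝ ∞ G q) (n : ℕ) (w : X) :
    fderiv ℝ (fun q : X × ℝ => iteratedDeriv n (fun t => G (q.1, t)) q.2) p (w, 0)
      = iteratedDeriv n (fun t => fderiv ℝ G (p.1, t) (w, 0)) p.2 := by
  induction n generalizing p with
  | zero => simp
  | succ n ih =>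
    set K : X × ℝ → F := fun q => iteratedDeriv n (fun t => G (q.1, t)) q.2 with hK
    have hKs : ∀ᶠ q in 𝓝 p, ContDiffAt ℝ ∞ K q := by
      filter_upwards [hG] with q hq using contDiffAt_iteratedDeriv_param hq n
    have hline : ∀ q : X × ℝ, HasDerivAt (fun t : ℝ => (q.1, t)) ((0 : X), (1 : ℝ)) q.2 :=
      fun q => (hasDerivAt_const _ _).prodMk (hasDerivAt_id _)
    have h1 : (fun q : X × ℝ => iteratedDeriv (n + 1) (fun t => G (q.1, t)) q.2)
        =ᶠ[𝓝 p] fun q => fderiv ℝ K q (0, 1) := by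
      filter_upwards [hKs] with q hq
      rw [iteratedDeriv_succ]
      exact (HasFDerivAt.comp_hasDerivAt q.2 (f := fun t : ℝ => (q.1, t))
        (hq.differentiableAt (by simp)).hasFDerivAt (hline q)).deriv
    have h2 : (fun t => fderiv ℝ K (p.1, t) (w, 0)) =ᶠ[𝓝 p.2]
        iteratedDeriv n fun t => fderiv ℝ G (p.1, t) (w, 0) := by
      have hc : Tendsto (fun t : ℝ => (p.1, t)) (𝓝 p.2) (𝓝 p) :=
        (hline p).continuousAt.tendsto
      filter_upwards [hc.eventually hG.eventually_nhds] with t ht using ih ht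
    have hp := hKs.self_of_nhds
    have hd : DifferentiableAt ℝ (fderiv ℝ K) p :=
      (hp.fderiv_right (m := ∞) (by simp)).differentiableAt (by simp)
    have hsymm : IsSymmSndFDerivAt ℝ K p :=
      hp.isSymmSndFDerivAt (by
      rw [minSmoothness_of_isRCLikeNormedField]; exact ENat.LEInfty.out)
    rw [h1.fderiv_eq, iteratedDeriv_succ, ← h2.deriv_eq, fderiv_clm_apply hd (by fun_prop)]
    have h3 : HasDerivAt (fun t : ℝ => fderiv ℝ K (p.1, t) (w, 0))
        (fderiv ℝ (fderiv ℝ K) p (0, 1) (w, 0)) p.2 := by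
      have := HasFDerivAt.comp_hasDerivAt p.2 (f := fun t : ℝ => (p.1, t)) hd.hasFDerivAt (hline p)
      simpa using this.clm_apply (hasDerivAt_const p.2 ((w, 0) : X × ℝ))
    rw [h3.deriv]
    simpa using hsymm.eq (w, 0) (0, 1)

lemma jetPoly_add_smul {k : ℕ} (u w : Fin (k + 1) → E) (a t : ℝ) :
    jetPoly (u + a • w) t = jetPoly u t + a • jetPoly w t := by
  simp only [jetPoly, Pi.add_apply, Pi.smul_apply, smul_add, Finset.sum_add_distrib,
    Finset.smul_sum, smul_comm a]

/-- The differential of the action of `f` on `k`-jets is the action on `k`-jets of the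
differential of `f`. -/
lemma fderiv_jetMap_apply {k : ℕ} {f : E → F} {u : Fin (k + 1) → E}
    (hf : ∀ᶠ y in 𝓝 (u 0), ContDiffAt ℝ ∞ f y) (w : Fin (k + 1) → E) (α : Fin (k + 1)) :
    fderiv ℝ (jetMap f (k := k)) u w α
      = iteratedDeriv α (fun s => fderiv ℝ f (jetPoly u s) (jetPoly w s)) 0 := by
  set G : (Fin (k + 1) → E) × ℝ → F := fun p => f (jetPoly p.1 p.2) with hG
  have hcont : Tendsto (fun p : (Fin (k + 1) → E) × ℝ => jetPoly p.1 p.2) (𝓝 (u, 0)) (𝓝 (u 0)) := by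
    simpa using (contDiff_jetPoly (E := E) (k := k)).continuous.tendsto (u, (0 : ℝ))
  have hGs : ∀ᶠ q in 𝓝 (u, (0 : ℝ)), ContDiffAt ℝ ∞ G q := by
    filter_upwards [hcont.eventually hf] with q hq
    exact ContDiffAt.comp q hq contDiff_jetPoly.contDiffAt
  have h1 := fderiv_iteratedDeriv_param hGs α w
  have hK : ContDiffAt ℝ ∞ (fun q : (Fin (k + 1) → E) × ℝ =>
      iteratedDeriv α (fun t => G (q.1, t)) q.2) (u, 0) :=
    contDiffAt_iteratedDeriv_param hGs.self_of_nhds α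
  have h2 : HasFDerivAt (fun v : Fin (k + 1) → E => (v, (0 : ℝ)))
      (ContinuousLinearMap.inl ℝ (Fin (k + 1) → E) ℝ) u :=
    hasFDerivAt_prodMk_left u 0
  have h3 := (HasFDerivAt.comp u (f := fun v : Fin (k + 1) → E => (v, (0 : ℝ)))
    (hK.differentiableAt (by simp)).hasFDerivAt h2).fderiv
  have h4 : DifferentiableAt ℝ (jetMap f (k := k)) u :=
    (contDiffAt_jetMap hf.self_of_nhds).differentiableAt (by simp)
  have h5 : fderiv ℝ (jetMap f (k := k)) u w α = fderiv ℝ (fun v => jetMap f v α) u w := by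
    rw [fderiv_pi (differentiableAt_pi.1 h4)]
    rfl
  rw [h5]
  change fderiv ℝ ((fun q : (Fin (k + 1) → E) × ℝ => iteratedDeriv α (fun t => G (q.1, t)) q.2) ∘
    fun v : Fin (k + 1) → E => (v, (0 : ℝ))) u w = _
  rw [h3]
  simp only [ContinuousLinearMap.comp_apply, ContinuousLinearMap.inl_apply]
  rw [h1]
  refine Filter.EventuallyEq.iteratedDeriv_eq _ ?_
  have hc0 : Tendsto (fun s : ℝ => (u, s)) (𝓝 0) (𝓝 (u, (0 : ℝ))) :=
    (Continuous.prodMk_right u).tendsto 0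
  filter_upwards [hc0.eventually (hcont.eventually hf)] with s hs
  have h6 : HasFDerivAt (fun p : (Fin (k + 1) → E) × ℝ => jetPoly p.1 p.2)
      (fderiv ℝ (fun p : (Fin (k + 1) → E) × ℝ => jetPoly p.1 p.2) (u, s)) (u, s) :=
    (contDiff_jetPoly.differentiable (by simp) _).hasFDerivAt
  have h7 : fderiv ℝ (fun p : (Fin (k + 1) → E) × ℝ => jetPoly p.1 p.2) (u, s) (w, 0)
      = jetPoly w s := by
    have h8 : HasDerivAt (fun a : ℝ => (u + a • w, s)) (w, (0 : ℝ)) 0 := by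
      have := ((hasDerivAt_id (0 : ℝ)).smul_const w).const_add u
      simpa using this.prodMk (hasDerivAt_const (0 : ℝ) s)
    have h9 := HasFDerivAt.comp_hasDerivAt (0 : ℝ) (f := fun a : ℝ => (u + a • w, s))
      (by simpa using h6) h8
    have h10 : HasDerivAt (fun a : ℝ => jetPoly u s + a • jetPoly w s) (jetPoly w s) 0 := by
      simpa using ((hasDerivAt_id (0 : ℝ)).smul_const (jetPoly w s)).const_add (jetPoly u s)
    refine h9.unique (h10.congr_of_eventuallyEq (Eventually.of_forall fun a => ?_))
    exact jetPoly_add_smul u w a s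
  have h11 := (HasFDerivAt.comp (u, s) (g := f) (hs.differentiableAt (by simp)).hasFDerivAt h6).fderiv
  change fderiv ℝ (f ∘ fun p : (Fin (k + 1) → E) × ℝ => jetPoly p.1 p.2) (u, s) (w, 0) = _
  rw [h11, ContinuousLinearMap.comp_apply, h7]

end Calculus

section Charts

variable {E : Type*} [NormedAddCommGroup E] [NormedSpace ℝ E] {H : Type*} [TopologicalSpace H]
  {I : ModelWithCorners ℝ E H} [I.Boundaryless] {k : ℕ} {M : Type*} [TopologicalSpace M]
  [ChartedSpace H M] [IsManifold I ∞ M]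

lemma contDiffAt_extChartAt_comp {n : WithTop ℕ∞} {γ : ℝ → M} {t : ℝ}
    (hγ : ContMDiffAt 𝓘(ℝ, ℝ) I n γ t) :
    ContDiffAt ℝ n (fun s => extChartAt I (γ t) (γ s)) t := by
  have := (contMDiffAt_iff.1 hγ).2
  simp only [extChartAt_model_space_eq_id, PartialEquiv.refl_symm, PartialEquiv.refl_coe,
    modelWithCornersSelf_coe, range_id, contDiffWithinAt_univ] at this
  exact this

/-- The adapted chart at `x` sends `j^k γ(t)` to the derivatives of orders `0, …, k` at `t` of `γ`
read in the chart at `x`, for a curve `γ` of class `C^k`. -/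
lemma velocityChart_prolong_of_contMDiffAt {γ : ℝ → M} {t : ℝ}
    (hγ : ContMDiffAt 𝓘(ℝ, ℝ) I k γ t) {x : M} (hx : γ t ∈ (extChartAt I x).source)
    (α : Fin (k + 1)) :
    velocityChart I k x (prolong I k γ t) α
      = iteratedDeriv α (fun s => extChartAt I x (γ s)) t := by
  have hc := contDiffAt_extChartAt_comp hγ
  have hc' : ContDiffAt ℝ k (fun s => extChartAt I (γ t) (γ (t + s))) 0 :=
    ContDiffAt.comp (0 : ℝ) (f := fun s => t + s) (by simpa using hc) (by fun_prop)
  have hs : ∀ (n : ℕ) (f : ℝ → E), iteratedDeriv n (fun s => f (t + s)) 0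
      = iteratedDeriv n f t := fun n f => by
    rw [iteratedDeriv_comp_const_add]; simp
  rw [← hs]
  have hcont : ∀ᶠ s in 𝓝 (0 : ℝ), γ (t + s) ∈ (extChartAt I (γ t)).source := by
    have h1 : ContinuousAt (fun s => γ (t + s)) 0 :=
      ContinuousAt.comp (f := fun s : ℝ => t + s) (by simpa using hγ.continuousAt) (by fun_prop)
    exact h1.preimage_mem_nhds ((isOpen_extChartAt_source (I := I) (γ t)).mem_nhds (by simp))
  have he : (fun s => extChartAt I x (γ (t + s))) =ᶠ[𝓝 0]
      (extChartAt I x ∘ (extChartAt I (γ t)).symm) ∘ fun s => extChartAt I (γ t) (γ (t + s)) := by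
    filter_upwards [hcont] with s hs
    simp only [Function.comp_apply]
    rw [(extChartAt I (γ t)).left_inv hs]
  have hα : ((α : ℕ) : WithTop ℕ∞) ≤ k := by exact_mod_cast Nat.lt_succ_iff.1 α.2
  rw [he.iteratedDeriv_eq]
  refine iteratedDeriv_comp_congr_of_contDiffAt (f := extChartAt I x ∘ (extChartAt I (γ t)).symm)
    (c := jetPoly (prolong I k γ t).coord)
    ((contDiff_jetPoly_right _).contDiffAt.of_le ENat.LEInfty.out) (hc'.of_le hα) ?_ fun i hi => ?_
  · rw [jetPoly_zero]
    exact (contDiffAt_coordChange (by simp [prolong]) (by simpa [prolong] using hx)).of_le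
      ENat.LEInfty.out
  · have h := iteratedDeriv_jetPoly (prolong I k γ t).coord ⟨i, lt_of_le_of_lt hi α.2⟩
    rw [h, hs i fun s => extChartAt I (γ t) (γ s)]
    cases i with
    | zero => simp [prolong]
    | succ i => rfl

lemma velocityChart_truncate {x : M} {v : Velocity I (k + 1) M}
    (hx : v.base ∈ (extChartAt I x).source) (α : Fin (k + 1)) :
    velocityChart I k x v.truncate α = velocityChart I (k + 1) x v α.castSucc := by
  have hf : ContDiffAt ℝ ∞ (extChartAt I x ∘ (extChartAt I v.base).symm) (v.coord 0) :=
    contDiffAt_coordChange (by simp) (by simpa using hx)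
  refine iteratedDeriv_comp_congr (f := extChartAt I x ∘ (extChartAt I v.base).symm)
    (contDiff_jetPoly_right _).contDiffAt (contDiff_jetPoly_right _).contDiffAt ?_ fun i hi => ?_
  · rw [jetPoly_zero]
    exact hf
  · have hi' : i < k + 1 := lt_of_le_of_lt hi α.2
    have h1 := iteratedDeriv_jetPoly v.truncate.coord ⟨i, hi'⟩
    have h2 := iteratedDeriv_jetPoly v.coord ⟨i, hi'.trans (Nat.lt_succ_self _)⟩
    refine h1.trans (Eq.trans ?_ h2.symm)
    cases i with
    | zero => rfl
    | succ i => rfl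

end Charts

section BundleCharts

variable {E : Type*} [NormedAddCommGroup E] [NormedSpace ℝ E] {H : Type*} [TopologicalSpace H]
  {I : ModelWithCorners ℝ E H} [I.Boundaryless] {k : ℕ} {M : Type*} [TopologicalSpace M]
  [ChartedSpace H M] [IsManifold I ∞ M]
  {F : Type*} [NormedAddCommGroup F] [NormedSpace ℝ F] {V : M → Type*}
  [TopologicalSpace (TotalSpace F V)] [∀ x, TopologicalSpace (V x)] [FiberBundle F V]

lemma jetPoly_coord (A : Velocity (I.prod 𝓘(ℝ, F)) k (TotalSpace F V)) (s : ℝ) :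
    jetPoly A.coord s = (jetPoly A.mapProj.coord s, jetPoly A.fib s) := by
  have h : ∀ α, A.coord α = (A.mapProj.coord α, A.fib α) := fun α => by
    refine Fin.cases ?_ (fun i => rfl) α
    refine Prod.ext ?_ rfl
    simp only [Velocity.coord_zero, FiberBundle.extChartAt]
    exact congrArg (extChartAt I A.base.proj)
      ((trivializationAt F V A.base.proj).coe_fst (FiberBundle.mem_trivializationAt_proj_source))
  simp only [jetPoly, h]
  refine Prod.ext ?_ ?_
  · simp [Prod.fst_sum]
  · simp [Prod.snd_sum]

lemma extChartAt_totalSpace_apply {z B : TotalSpace F V}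
    (hB : B ∈ (extChartAt (I.prod 𝓘(ℝ, F)) z).source) :
    extChartAt (I.prod 𝓘(ℝ, F)) z B
      = (extChartAt I z.proj B.proj, (trivializationAt F V z.proj B).2) := by
  rw [FiberBundle.extChartAt] at hB ⊢
  simp only [PartialEquiv.trans_source, mem_inter_iff] at hB
  simp only [PartialEquiv.coe_trans, Function.comp_apply, PartialEquiv.prod_coe,
    PartialEquiv.refl_coe, id]
  rw [← (trivializationAt F V z.proj).coe_fst hB.1]
  rfl

lemma proj_extChartAt_symm {z : TotalSpace F V} {w : E × F}
    (hw : w ∈ (extChartAt (I.prod 𝓘(ℝ, F)) z).target) :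
    ((extChartAt (I.prod 𝓘(ℝ, F)) z).symm w).proj = (extChartAt I z.proj).symm w.1 := by
  have h := (extChartAt (I.prod 𝓘(ℝ, F)) z).map_target hw
  have h1 := congrArg Prod.fst ((extChartAt_totalSpace_apply h).symm.trans
    ((extChartAt (I.prod 𝓘(ℝ, F)) z).right_inv hw))
  simp only at h1
  rw [← h1, (extChartAt I z.proj).left_inv]
  rw [FiberBundle.extChartAt] at h
  simp only [PartialEquiv.trans_source, mem_inter_iff] at h
  have h2 := h.2
  simp only [mem_preimage, PartialEquiv.prod_source, mem_prod] at h2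
  have h3 := (trivializationAt F V z.proj).coe_fst h.1
  rw [FiberBundle.extChartAt]
  exact h3 ▸ h2.1

/-- The curve that represents a `k`-velocity stays in the domain of a chart for small times. -/
lemma eventually_mem_source_of_jetPoly {N : Type*} [TopologicalSpace N] {E' H' : Type*}
    [NormedAddCommGroup E'] [NormedSpace ℝ E'] [TopologicalSpace H']
    {J : ModelWithCorners ℝ E' H'} [J.Boundaryless] [ChartedSpace H' N] {A : Velocity J k N} {z : N}
    (hA : A.base ∈ (extChartAt J z).source) :
    ∀ᶠ s in 𝓝 (0 : ℝ), jetPoly A.coord s ∈ (extChartAt J A.base).target ∧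
      (extChartAt J A.base).symm (jetPoly A.coord s) ∈ (extChartAt J z).source := by
  have hc : Tendsto (jetPoly A.coord) (𝓝 0) (𝓝 (extChartAt J A.base A.base)) := by
    simpa using (contDiff_jetPoly_right A.coord).continuous.tendsto 0
  refine (hc.eventually ((isOpen_extChartAt_target (I := J) A.base).mem_nhds (by simp))).and ?_
  have h2 : Tendsto (extChartAt J A.base).symm (𝓝 (extChartAt J A.base A.base)) (𝓝 A.base) := by
    simpa using (continuousAt_extChartAt_symm (I := J) A.base).tendsto
  exact (h2.comp hc).eventually ((isOpen_extChartAt_source (I := J) z).mem_nhds hA)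

lemma contDiffAt_jetPoly_chart {N : Type*} [TopologicalSpace N] {E' H' : Type*}
    [NormedAddCommGroup E'] [NormedSpace ℝ E'] [TopologicalSpace H']
    {J : ModelWithCorners ℝ E' H'} [J.Boundaryless] [ChartedSpace H' N] [IsManifold J ∞ N]
    {A : Velocity J k N} {z : N} (hA : A.base ∈ (extChartAt J z).source) :
    ContDiffAt ℝ ∞ (fun s => extChartAt J z ((extChartAt J A.base).symm (jetPoly A.coord s))) 0 := by
  refine ContDiffAt.comp (0 : ℝ) (g := extChartAt J z ∘ (extChartAt J A.base).symm) ?_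
    (contDiff_jetPoly_right A.coord).contDiffAt
  rw [jetPoly_zero]
  exact contDiffAt_coordChange (by simp) (by simpa using hA)

variable [IsManifold (I.prod 𝓘(ℝ, F)) ∞ (TotalSpace F V)]

/-- In adapted coordinates, the projection `T^k V → T^k M` is the projection onto the first
components. -/
lemma velocityChart_fst {A : Velocity (I.prod 𝓘(ℝ, F)) k (TotalSpace F V)} {z : TotalSpace F V}
    (hA : A.base ∈ (extChartAt (I.prod 𝓘(ℝ, F)) z).source) (α : Fin (k + 1)) :
    (velocityChart (I.prod 𝓘(ℝ, F)) k z A α).1 = velocityChart I k z.proj A.mapProj α := by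
  refine (iteratedDeriv_fst ((contDiffAt_jetPoly_chart hA).of_le ENat.LEInfty.out)).trans ?_
  refine Filter.EventuallyEq.iteratedDeriv_eq _ ?_
  filter_upwards [eventually_mem_source_of_jetPoly hA] with s hs
  simp only [Function.comp_apply]
  rw [extChartAt_totalSpace_apply hs.2, proj_extChartAt_symm hs.1, jetPoly_coord]
  rfl

/-- The linear adapted coordinates are the derivatives of the linear coordinate of the
representing curve. -/
lemma velocityChart_snd {A : Velocity (I.prod 𝓘(ℝ, F)) k (TotalSpace F V)} {z : TotalSpace F V}
    (hA : A.base ∈ (extChartAt (I.prod 𝓘(ℝ, F)) z).source) (α : Fin (k + 1)) :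
    (velocityChart (I.prod 𝓘(ℝ, F)) k z A α).2 = iteratedDeriv α (fun s => (extChartAt
      (I.prod 𝓘(ℝ, F)) z ((extChartAt (I.prod 𝓘(ℝ, F)) A.base).symm (jetPoly A.coord s))).2) 0 :=
  iteratedDeriv_snd ((contDiffAt_jetPoly_chart hA).of_le ENat.LEInfty.out)

end BundleCharts

section Invariance

variable {E : Type*} [NormedAddCommGroup E] [NormedSpace ℝ E] {H : Type*} [TopologicalSpace H]
  {I : ModelWithCorners ℝ E H} [I.Boundaryless] {k : ℕ} {M : Type*} [TopologicalSpace M]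
  [ChartedSpace H M] [IsManifold I ∞ M]

/-- The pairing of covectors and vectors does not depend on the trivialization. -/
lemma trivializationAt_cotangent_apply {x y : M} (hy : y ∈ (extChartAt I x).source)
    (q : TangentSpace I y →L[ℝ] ℝ) (v : TangentSpace I y) :
    (trivializationAt (E →L[ℝ] ℝ) (fun x : M => TangentSpace I x →L[ℝ] ℝ) x ⟨y, q⟩).2
      (trivializationAt E (TangentSpace I) x ⟨y, v⟩).2 = q v := by
  have hb : y ∈ (trivializationAt E (TangentSpace I : M → Type _) x).baseSet := by
    simpa using hy
  rw [hom_trivializationAt_apply]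
  simp only [ContinuousLinearMap.inCoordinates, ContinuousLinearMap.comp_apply]
  have h := (trivializationAt E (TangentSpace I : M → Type _) x).symm_apply_apply_mk hb v
  rw [Trivialization.symmL_apply _ hb, h]
  simp

lemma mem_extChartAt_totalSpace_source {F : Type*} [NormedAddCommGroup F] [NormedSpace ℝ F]
    {V : M → Type*} [TopologicalSpace (TotalSpace F V)] [∀ x, TopologicalSpace (V x)]
    [FiberBundle F V] {z B : TotalSpace F V}
    (h1 : B.proj ∈ (trivializationAt F V z.proj).baseSet)
    (h2 : B.proj ∈ (extChartAt I z.proj).source) :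
    B ∈ (extChartAt (I.prod 𝓘(ℝ, F)) z).source := by
  rw [FiberBundle.extChartAt]
  simp only [PartialEquiv.trans_source, mem_inter_iff]
  have h3 : B ∈ (trivializationAt F V z.proj).source := by
    rwa [(trivializationAt F V z.proj).mem_source]
  refine ⟨h3, ?_⟩
  simp only [mem_preimage, PartialEquiv.prod_source, mem_prod, PartialEquiv.refl_source, mem_univ,
    and_true]
  have h4 := (trivializationAt F V z.proj).coe_fst h3
  exact h4.symm ▸ h2

lemma mem_extChartAt_tangent_source {z B : TangentBundle I M} :
    B ∈ (extChartAt I.tangent z).source ↔ B.proj ∈ (extChartAt I z.proj).source := by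
  simp

lemma mem_extChartAt_cotangent_source {z B : CotangentBundle I M}
    (h : B.proj ∈ (extChartAt I z.proj).source) :
    B ∈ (extChartAt (I.prod 𝓘(ℝ, E →L[ℝ] ℝ)) z).source := by
  refine mem_extChartAt_totalSpace_source ?_ h
  rw [hom_trivializationAt_baseSet]
  refine ⟨by simpa using h, by simp⟩

/-- The pairing in coordinates: for representing curves `(u, p)` and `(u, v)`. -/
lemma cotangent_tangent_chart_pairing {ζ ζ' : CotangentBundle I M} {z z' : TangentBundle I M}
    (hz : ζ.proj = z.proj) (hz' : ζ'.proj = z'.proj) {u v : E} {p : E →L[ℝ] ℝ}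
    (hu : u ∈ (extChartAt I z'.proj).target)
    (hu' : (extChartAt I z'.proj).symm u ∈ (extChartAt I z.proj).source) :
    (extChartAt (I.prod 𝓘(ℝ, E →L[ℝ] ℝ)) ζ
        ((extChartAt (I.prod 𝓘(ℝ, E →L[ℝ] ℝ)) ζ').symm (u, p))).2
      (extChartAt I.tangent z ((extChartAt I.tangent z').symm (u, v))).2 = p v := by
  have ht : (u, v) ∈ (extChartAt I.tangent z').target := by
    rw [FiberBundle.extChartAt_target]
    refine ⟨⟨hu, ?_⟩, mem_univ _⟩
    simpa using (extChartAt I z'.proj).map_target hu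
  have ht' : (u, p) ∈ (extChartAt (I.prod 𝓘(ℝ, E →L[ℝ] ℝ)) ζ').target := by
    rw [FiberBundle.extChartAt_target]
    refine ⟨⟨by rwa [hz'], ?_⟩, mem_univ _⟩
    rw [hz', hom_trivializationAt_baseSet]
    exact ⟨by simpa using (extChartAt I z'.proj).map_target hu, by simp⟩
  have hB := (extChartAt I.tangent z').map_target ht
  have hA := (extChartAt (I.prod 𝓘(ℝ, E →L[ℝ] ℝ)) ζ').map_target ht'
  have hBp := proj_extChartAt_symm ht
  have hAp := proj_extChartAt_symm ht'
  have hBr := ((extChartAt I.tangent z').right_inv ht)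
  have hAr := ((extChartAt (I.prod 𝓘(ℝ, E →L[ℝ] ℝ)) ζ').right_inv ht')
  rw [hz'] at hAp
  simp only at hAp hBp
  generalize (extChartAt I.tangent z').symm (u, v) = B at *
  generalize (extChartAt (I.prod 𝓘(ℝ, E →L[ℝ] ℝ)) ζ').symm (u, p) = A at *
  rw [extChartAt_totalSpace_apply hB] at hBr
  rw [extChartAt_totalSpace_apply hA] at hAr
  have hy : B.proj ∈ (extChartAt I z.proj).source := by rwa [hBp]
  have hy' : A.proj ∈ (extChartAt I ζ.proj).source := by rwa [hAp, hz]
  rw [extChartAt_totalSpace_apply (mem_extChartAt_tangent_source.2 hy),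
    extChartAt_totalSpace_apply (mem_extChartAt_cotangent_source hy')]
  obtain ⟨yB, v'⟩ := B
  obtain ⟨yA, q⟩ := A
  obtain rfl : yA = yB := hAp.trans hBp.symm
  simp only at hy hy' ⊢
  have e1 : v = (trivializationAt E (TangentSpace I) z'.proj ⟨yA, v'⟩).2 :=
    (congrArg Prod.snd hBr).symm
  have e2 : p = (trivializationAt (E →L[ℝ] ℝ) (fun x : M => TangentSpace I x →L[ℝ] ℝ)
    ζ'.proj ⟨yA, q⟩).2 := (congrArg Prod.snd hAr).symm
  rw [e1, e2, hz, hz', trivializationAt_cotangent_apply hy, trivializationAt_cotangent_apply]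
  exact mem_extChartAt_tangent_source.1 hB

/-- The lifted pairing has the same expression in all adapted coordinates. -/
lemma sum_velocityChart_pairing {A : Velocity (I.prod 𝓘(ℝ, E →L[ℝ] ℝ)) k (CotangentBundle I M)}
    {X : Velocity I.tangent k (TangentBundle I M)} (hAX : A.mapProj = X.mapProj)
    {ζ : CotangentBundle I M} {z : TangentBundle I M} (hz : ζ.proj = z.proj)
    (hX : X.base.proj ∈ (extChartAt I z.proj).source) :
    ∑ α : Fin (k + 1), (k.choose α : ℝ) *
      (velocityChart (I.prod 𝓘(ℝ, E →L[ℝ] ℝ)) k ζ A α).2 (velocityChart I.tangent k z X α.rev).2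
      = pairing A X := by
  have hb : A.base.proj = X.base.proj := congrArg Velocity.base hAX
  have hX' : X.base ∈ (extChartAt I.tangent z).source := mem_extChartAt_tangent_source.2 hX
  have hA' : A.base ∈ (extChartAt (I.prod 𝓘(ℝ, E →L[ℝ] ℝ)) ζ).source :=
    mem_extChartAt_cotangent_source (by rwa [hb, hz])
  set a : ℝ → E →L[ℝ] ℝ := fun s => (extChartAt (I.prod 𝓘(ℝ, E →L[ℝ] ℝ)) ζ
    ((extChartAt (I.prod 𝓘(ℝ, E →L[ℝ] ℝ)) A.base).symm (jetPoly A.coord s))).2 with ha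
  set ξ : ℝ → E := fun s => (extChartAt I.tangent z
    ((extChartAt I.tangent X.base).symm (jetPoly X.coord s))).2 with hξ
  have has : ContDiffAt ℝ ∞ a 0 := (contDiffAt_jetPoly_chart hA').snd
  have hξs : ContDiffAt ℝ ∞ ξ 0 := (contDiffAt_jetPoly_chart hX').snd
  have hev : (fun s => a s (ξ s)) =ᶠ[𝓝 0] fun s => jetPoly A.fib s (jetPoly X.fib s) := by
    filter_upwards [eventually_mem_source_of_jetPoly (A := X.mapProj) hX] with s hs
    simp only [ha, hξ, jetPoly_coord]
    rw [hAX]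
    exact cotangent_tangent_chart_pairing hz hb hs.1 hs.2
  have key := hev.iteratedDeriv_eq k
  rw [iteratedDeriv_clm_apply (has.of_le ENat.LEInfty.out) (hξs.of_le ENat.LEInfty.out),
    iteratedDeriv_clm_apply ((contDiff_jetPoly_right _).contDiffAt.of_le ENat.LEInfty.out)
      ((contDiff_jetPoly_right _).contDiffAt.of_le ENat.LEInfty.out),
    Finset.sum_range, Finset.sum_range] at key
  simp only [smul_eq_mul] at key
  have hrev : ∀ α : Fin (k + 1), k - (α : ℕ) = (α.rev : ℕ) := fun α => by
    rw [Fin.val_rev]; omega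
  simp only [hrev, iteratedDeriv_jetPoly] at key
  rw [pairing, ← key]
  refine Finset.sum_congr rfl fun α _ => ?_
  rw [velocityChart_snd hA', velocityChart_snd hX']

end Invariance

section DifferentialCharts

variable {E : Type*} [NormedAddCommGroup E] [NormedSpace ℝ E] {H : Type*} [TopologicalSpace H]
  {I : ModelWithCorners ℝ E H} [I.Boundaryless] {k : ℕ} {M : Type*} [TopologicalSpace M]
  [ChartedSpace H M] [IsManifold I ∞ M]

/-- The coordinate changes of `T M` are the differentials of those of `M`. -/
lemma extChartAt_tangent_coordChange_snd {z z' : TangentBundle I M} {u v : E}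
    (hu : u ∈ (extChartAt I z'.proj).target)
    (hu' : (extChartAt I z'.proj).symm u ∈ (extChartAt I z.proj).source) :
    (extChartAt I.tangent z ((extChartAt I.tangent z').symm (u, v))).2
      = fderiv ℝ (extChartAt I z.proj ∘ (extChartAt I z'.proj).symm) u v := by
  have ht : (u, v) ∈ (extChartAt I.tangent z').target := by
    rw [FiberBundle.extChartAt_target]
    refine ⟨⟨hu, ?_⟩, mem_univ _⟩
    simpa using (extChartAt I z'.proj).map_target hu
  have hB := (extChartAt I.tangent z').map_target ht
  have hBp := proj_extChartAt_symm ht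
  have hBr := ((extChartAt I.tangent z').right_inv ht)
  simp only at hBp
  generalize (extChartAt I.tangent z').symm (u, v) = B at *
  rw [extChartAt_totalSpace_apply hB] at hBr
  have hy : B.proj ∈ (extChartAt I z.proj).source := by rwa [hBp]
  rw [extChartAt_totalSpace_apply (mem_extChartAt_tangent_source.2 hy)]
  have e1 : v = tangentCoordChange I B.proj z'.proj B.proj B.2 :=
    (congrArg Prod.snd hBr).symm
  have e2 : u = extChartAt I z'.proj B.proj := (congrArg Prod.fst hBr).symm
  change tangentCoordChange I B.proj z.proj B.proj B.2 = _
  rw [← fderivWithin_univ, ← I.range_eq_univ, e2, ← tangentCoordChange_def, e1]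
  exact (tangentCoordChange_comp
    ⟨⟨by simp, mem_extChartAt_tangent_source.1 hB⟩, hy⟩).symm

lemma eventually_contDiffAt_coordChange {x y : M} {u : E} (hu : u ∈ (extChartAt I x).target)
    (hy : (extChartAt I x).symm u ∈ (extChartAt I y).source) :
    ∀ᶠ w in 𝓝 u, ContDiffAt ℝ ∞ (extChartAt I y ∘ (extChartAt I x).symm) w := by
  have hc : ContinuousAt (extChartAt I x).symm u := continuousAt_extChartAt_symm'' hu
  filter_upwards [(isOpen_extChartAt_target (I := I) x).mem_nhds hu,
    hc.preimage_mem_nhds ((isOpen_extChartAt_source (I := I) y).mem_nhds hy)] with w h1 h2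
  exact contDiffAt_coordChange h1 h2

/-- In adapted coordinates, the canonical flip interchanges the two orders of differentiation. -/
lemma velocityChart_tangent_snd {X : Velocity I.tangent k (TangentBundle I M)}
    {z : TangentBundle I M} (hX : X.base.proj ∈ (extChartAt I z.proj).source) :
    (fun α => (velocityChart I.tangent k z X α).2) = fderiv ℝ
      (jetMap (extChartAt I z.proj ∘ (extChartAt I X.base.proj).symm) (k := k)) X.mapProj.coord
      X.fib := by
  funext α
  have hX' : X.base ∈ (extChartAt I.tangent z).source := mem_extChartAt_tangent_source.2 hX
  have h0 : X.mapProj.coord 0 = extChartAt I X.base.proj X.base.proj := rfl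
  rw [fderiv_jetMap_apply (eventually_contDiffAt_coordChange (by rw [h0]; simp)
    (by rw [h0]; simpa using hX)), velocityChart_snd hX']
  refine Filter.EventuallyEq.iteratedDeriv_eq _ ?_
  filter_upwards [eventually_mem_source_of_jetPoly (A := X.mapProj) hX] with s hs
  simp only [jetPoly_coord]
  exact extChartAt_tangent_coordChange_snd hs.1 hs.2

lemma contDiffAt_comp_velocityChart_symm {L : Velocity I k M → ℝ}
    (hL : ContMDiff 𝓘(ℝ, Fin (k + 1) → E) 𝓘(ℝ, ℝ) ∞ L) {x : M} {u : Fin (k + 1) → E}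
    (hu : u 0 ∈ (extChartAt I x).target) :
    ContDiffAt ℝ ∞ (L ∘ (velocityChart I k x).symm) u := by
  let v₀ : Velocity I k M := ⟨x, 0⟩
  have h1 : ContMDiffAt 𝓘(ℝ, Fin (k + 1) → E) 𝓘(ℝ, Fin (k + 1) → E) ∞
      (extChartAt 𝓘(ℝ, Fin (k + 1) → E) v₀).symm u :=
    (contMDiffOn_extChartAt_symm (I := 𝓘(ℝ, Fin (k + 1) → E)) (n := ∞) v₀).contMDiffAt
      ((isOpen_extChartAt_target (I := 𝓘(ℝ, Fin (k + 1) → E)) v₀).mem_nhds (by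
        simp only [extChartAt, mfld_simps]; exact hu))
  exact ((hL.contMDiffAt).comp u h1).contDiffAt

/-- The differential of a function on `T^k M` in adapted coordinates. -/
lemma mfderiv_canonicalFlip {L : Velocity I k M → ℝ}
    (hL : ContMDiff 𝓘(ℝ, Fin (k + 1) → E) 𝓘(ℝ, ℝ) ∞ L)
    {X : Velocity I.tangent k (TangentBundle I M)}
    {z : TangentBundle I M} (hX : X.base.proj ∈ (extChartAt I z.proj).source) :
    mfderiv 𝓘(ℝ, Fin (k + 1) → E) 𝓘(ℝ, ℝ) L (canonicalFlip X).proj (canonicalFlip X).2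
      = fderiv ℝ (L ∘ (velocityChart I k z.proj).symm) (velocityChart I k z.proj X.mapProj)
        fun α => (velocityChart I.tangent k z X α).2 := by
  set v := X.mapProj with hv
  have h1 : mfderiv 𝓘(ℝ, Fin (k + 1) → E) 𝓘(ℝ, ℝ) L v
      = fderiv ℝ (L ∘ (velocityChart I k v.base).symm) v.coord := by
    refine (hL.contMDiffAt (x := v)).mdifferentiableAt (by simp) |>.mfderiv.trans ?_
    change fderivWithin ℝ (L ∘ (velocityChart I k v.base).symm) (range id)
      (extChartAt 𝓘(ℝ, Fin (k + 1) → E) v v) = _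
    rw [extChartAt_velocity_self, range_id, fderivWithin_univ]
  have hmem : v.coord 0 ∈ (extChartAt I v.base).target := by simp
  have hmem' : (extChartAt I v.base).symm (v.coord 0) ∈ (extChartAt I z.proj).source := by
    rw [Velocity.coord_zero, extChartAt_to_inv]
    exact hX
  set τ := extChartAt I z.proj ∘ (extChartAt I v.base).symm with hτ
  have hval : velocityChart I k z.proj v = jetMap τ v.coord := rfl
  have hev : L ∘ (velocityChart I k v.base).symm =ᶠ[𝓝 v.coord]
      (L ∘ (velocityChart I k z.proj).symm) ∘ jetMap τ := by
    have hopen : v.coord ∈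
        ((velocityChart I k v.base).symm.trans (velocityChart I k z.proj)).source := by
      rw [velocityChart_trans_source, mem_ofPred_eq, PartialEquiv.trans_source]
      exact ⟨hmem, hmem'⟩
    filter_upwards [(isOpen_velocityChart_trans_source v.base z.proj).mem_nhds hopen] with u hu
    have h2 := velocityChart_trans_apply v.base z.proj hu
    simp only [Function.comp_apply]
    rw [← hτ] at h2
    rw [← h2]
    simp only [PartialEquiv.coe_trans, Function.comp_apply]
    rw [(velocityChart I k z.proj).left_inv]
    exact hu.2
  have hj : DifferentiableAt ℝ (jetMap τ (k := k)) v.coord :=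
    (contDiffAt_jetMap (contDiffAt_coordChange hmem hmem')).differentiableAt (by simp)
  have hl : DifferentiableAt ℝ (L ∘ (velocityChart I k z.proj).symm) (jetMap τ v.coord) := by
    refine (contDiffAt_comp_velocityChart_symm hL ?_).differentiableAt (by simp)
    rw [jetMap_zero]
    exact (extChartAt I z.proj).map_source hmem'
  change mfderiv 𝓘(ℝ, Fin (k + 1) → E) 𝓘(ℝ, ℝ) L v X.fib = _
  rw [h1, hev.fderiv_eq, fderiv_comp _ hl hj, velocityChart_tangent_snd hX, hval]
  rfl

/-- The map `Λ_L` in adapted coordinates. -/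
lemma velocityChart_bigLambda {L : Velocity I k M → ℝ}
    (hL : ContMDiff 𝓘(ℝ, Fin (k + 1) → E) 𝓘(ℝ, ℝ) ∞ L) {v : Velocity I k M}
    {ζ : CotangentBundle I M} (hv : v.base ∈ (extChartAt I ζ.proj).source) (α : Fin (k + 1)) :
    velocityChart (I.prod 𝓘(ℝ, E →L[ℝ] ℝ)) k ζ (bigLambda L v) α
      = (velocityChart I k ζ.proj v α, lower (fderiv ℝ (L ∘ (velocityChart I k ζ.proj).symm)
        (velocityChart I k ζ.proj v)) α) := by
  set A := bigLambda L v with hA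
  have hAm : A.mapProj = v := Velocity.mapProj_ofFib _ _
  have hAb : A.base ∈ (extChartAt (I.prod 𝓘(ℝ, E →L[ℝ] ℝ)) ζ).source :=
    mem_extChartAt_cotangent_source hv
  refine Prod.ext ?_ ?_
  · rw [velocityChart_fst hAb, hAm]
  · refine ContinuousLinearMap.ext fun e => ?_
    set z : TangentBundle I M := ⟨ζ.proj, 0⟩ with hz
    set w : Fin (k + 1) → E × E :=
      fun β => (velocityChart I k ζ.proj v β, Pi.single (M := fun _ => E) α.rev e β) with hw
    have hwt : w ∈ (velocityChart I.tangent k z).target := by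
      change w 0 ∈ (extChartAt I.tangent z).target
      rw [FiberBundle.extChartAt_target]
      have h0 : (w 0).1 = extChartAt I ζ.proj v.base := by
        simp [hw, velocityChart, jetMap_zero]
      refine ⟨⟨?_, ?_⟩, mem_univ _⟩
      · rw [h0]; exact (extChartAt I ζ.proj).map_source hv
      · rw [mem_preimage, h0]
        simpa using (extChartAt I ζ.proj).map_target ((extChartAt I ζ.proj).map_source hv)
    set X := (velocityChart I.tangent k z).symm w with hX
    have hXs : X.base ∈ (extChartAt I.tangent z).source :=
      (velocityChart I.tangent k z).map_target hwt
    have hXs' : X.base.proj ∈ (extChartAt I z.proj).source := mem_extChartAt_tangent_source.1 hXs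
    have hXw : velocityChart I.tangent k z X = w := (velocityChart I.tangent k z).right_inv hwt
    have hXm : X.mapProj = v := by
      refine (velocityChart I k ζ.proj).injOn hXs' hv (funext fun β => ?_)
      have := velocityChart_fst hXs β
      rw [hXw] at this
      exact this.symm
    have key := sum_velocityChart_pairing (A := A) (X := X) (hAm.trans hXm.symm) (ζ := ζ) (z := z)
      rfl hXs'
    have key2 := (mfderiv_canonicalFlip hL hXs').symm.trans (apply_canonicalFlip X
      (mfderiv 𝓘(ℝ, Fin (k + 1) → E) 𝓘(ℝ, ℝ) L (canonicalFlip X).proj))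
    have hAX : dualFlip ⟨(canonicalFlip X).proj,
        mfderiv 𝓘(ℝ, Fin (k + 1) → E) 𝓘(ℝ, ℝ) L (canonicalFlip X).proj⟩ = A := by
      have : (canonicalFlip X).proj = v := hXm
      rw [this]
      rfl
    have hsnd : (fun β => (w β).2) = Pi.single (M := fun _ => E) α.rev e := rfl
    rw [hAX, ← key, hXw, hXm, hsnd] at key2
    simp only [hw] at key2
    rw [Finset.sum_eq_single α] at key2
    · simp only [Pi.single_eq_same] at key2
      simp only [lower, _root_.smul_apply, ContinuousLinearMap.comp_apply, smul_eq_mul,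
        ContinuousLinearMap.single_apply]
      rw [eq_inv_mul_iff_mul_eq₀ (choose_ne_zero α)]
      exact key2.symm
    · intro β _ hβ
      have : β.rev ≠ α.rev := fun h => hβ (Fin.rev_injective h)
      simp [this]
    · simp

end DifferentialCharts

section ProductRules

variable {E : Type*} [NormedAddCommGroup E] [NormedSpace ℝ E]

lemma iteratedDeriv_iteratedDeriv {F : Type*} [NormedAddCommGroup F] [NormedSpace ℝ F]
    (m n : ℕ) (f : ℝ → F) : iteratedDeriv m (iteratedDeriv n f) = iteratedDeriv (m + n) f := by
  simp only [iteratedDeriv_eq_iterate, Function.iterate_add_apply]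

/-- The derivatives at `s` of the product with the Taylor monomial `(r - s)^m / m!`. -/
lemma iteratedDeriv_taylor_smul {d : ℝ → E} {s : ℝ} {n : ℕ} (hd : ContDiffAt ℝ n d s) (m : ℕ) :
    iteratedDeriv n (fun r => ((r - s) ^ m / (m.factorial : ℝ)) • d r) s
      = (n.choose m : ℝ) • iteratedDeriv (n - m) d s := by
  have hw : ∀ i, iteratedDeriv i (fun r : ℝ => (r - s) ^ m / (m.factorial : ℝ)) s
      = if i = m then 1 else 0 := fun i => by
    have h1 : (fun r : ℝ => (r - s) ^ m / (m.factorial : ℝ))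
        = fun r => (fun q : ℝ => ((m.factorial : ℝ))⁻¹ * q ^ m) (r - s) := by
      funext r; simp only [div_eq_inv_mul]
    rw [h1, iteratedDeriv_comp_sub_const (f := fun q : ℝ => ((m.factorial : ℝ))⁻¹ * q ^ m)]
    simp only [sub_self]
    rw [iteratedDeriv_const_mul_field,
      iteratedDeriv_fun_pow_zero]
    have h3 : (m.factorial : ℝ) ≠ 0 := by positivity
    by_cases him : i = m
    · subst him; simp [h3]
    · simp [him]
  have hws : ContDiffAt ℝ n (fun r : ℝ => (r - s) ^ m / (m.factorial : ℝ)) s := by fun_prop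
  have h := iteratedDerivWithin_smul (mem_univ s) uniqueDiffOn_univ
    hws.contDiffWithinAt hd.contDiffWithinAt
  simp only [iteratedDerivWithin_univ, hw] at h
  refine h.trans ?_
  simp only [ite_smul, one_smul, zero_smul, smul_ite, smul_zero, Finset.sum_ite_eq', Finset.mem_range]
  split_ifs with hm
  · rw [Nat.cast_smul_eq_nsmul]
  · rw [Nat.choose_eq_zero_of_lt (by omega), Nat.cast_zero, zero_smul]

/-- Summation over the subsets of `Fin k` according to their traces on an initial segment. -/
lemma sum_card_filter_lt {k j : ℕ} (hj : j ≤ k) (g : ℕ → ℕ → ℝ) :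
    ∑ ε : Finset (Fin k), g (ε.filter fun i : Fin k => (i : ℕ) < j).card
        (ε.filter fun i : Fin k => ¬ (i : ℕ) < j).card
      = ∑ a ∈ Finset.range (j + 1), ∑ b ∈ Finset.range (k - j + 1),
        (j.choose a * (k - j).choose b : ℝ) * g a b := by
  set A : Finset (Fin k) := Finset.univ.filter fun i : Fin k => (i : ℕ) < j with hA
  have hc : A.card = j := by simp [hA, Fin.card_filter_val_lt, hj]
  have := sum_card_inter A g
  rw [hc] at this
  rw [← this]
  refine Finset.sum_congr rfl fun ε _ => ?_
  congr 2 <;> ext i <;> simp [hA]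

lemma choose_mul_choose_shift {k e j b : ℕ} (hj : j ≤ k) (hb : b ≤ k - j) :
    (k + e).choose (j + e) * (k - j).choose b = (k + e).choose b * (k + e - b).choose (j + e) := by
  have h1 : (k + e).choose (k - j) = (k + e).choose (j + e) := by
    rw [← Nat.choose_symm (by omega)]; congr 1; omega
  rw [← h1, Nat.choose_mul hb]
  congr 1
  rw [← Nat.choose_symm (by omega)]; congr 1; omega

/-- The alternating sum of the derivatives of the functions
`∑ α, (α choose j + e) p_α d^{(α - j - e)}`, expanded by the Leibniz rule. -/
lemma sum_iteratedDeriv_weighted {k e : ℕ} {p : ℕ → ℝ → E →L[ℝ] ℝ} {d : ℝ → E} {t : ℝ}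
    (hp : ∀ α, ContDiffAt ℝ ∞ (p α) t) (hd : ContDiffAt ℝ ∞ d t) {j : ℕ} (hj : j ≤ k)
    {g : ℕ → ℕ → ℝ} (hg : ∀ a b, g a b = ((k + e).choose b : ℝ)⁻¹ *
      iteratedDeriv a (p (k + e - b)) t (iteratedDeriv (k - (a + b)) d t)) :
    iteratedDeriv j (fun s => ∑ α ∈ Finset.range (k + e + 1),
        (α.choose (j + e) : ℝ) * p α s (iteratedDeriv (α - (j + e)) d s)) t
      = ((k + e).choose (j + e) : ℝ) * ∑ ε : Finset (Fin k),
        g (ε.filter fun i : Fin k => (i : ℕ) < j).card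
          (ε.filter fun i : Fin k => ¬ (i : ℕ) < j).card := by
  have hdi : ∀ i, ContDiffAt ℝ ∞ (iteratedDeriv i d) t := fun i => contDiffAt_iteratedDeriv hd i
  have hle : (j : WithTop ℕ∞) ≤ ∞ := ENat.LEInfty.out
  rw [iteratedDeriv_fun_sum fun α _ => (contDiffAt_const.mul ((hp α).clm_apply (hdi _))).of_le hle,
    sum_card_filter_lt hj, Finset.sum_comm, Finset.mul_sum]
  have hterm : ∀ α, iteratedDeriv j (fun s => (α.choose (j + e) : ℝ) *
      p α s (iteratedDeriv (α - (j + e)) d s)) t = (α.choose (j + e) : ℝ) *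
      ∑ a ∈ Finset.range (j + 1), (j.choose a : ℝ) *
        iteratedDeriv a (p α) t (iteratedDeriv (j - a + (α - (j + e))) d t) := fun α => by
    rw [iteratedDeriv_const_mul_field, iteratedDeriv_clm_apply ((hp α).of_le hle)
      ((hdi _).of_le hle)]
    simp only [smul_eq_mul, iteratedDeriv_iteratedDeriv]
  rw [Finset.sum_congr rfl fun α _ => hterm α, ← Finset.sum_range_reflect]
  have hsub : Finset.range (k - j + 1) ⊆ Finset.range (k + e + 1) :=
    Finset.range_subset_range.2 (by omega)
  rw [← Finset.sum_subset hsub]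
  · refine Finset.sum_congr rfl fun b hb => ?_
    have hb' : b ≤ k - j := Nat.lt_succ_iff.1 (Finset.mem_range.1 hb)
    have e1 : k + e + 1 - 1 - b = k + e - b := by omega
    rw [e1, Finset.mul_sum, Finset.mul_sum]
    refine Finset.sum_congr rfl fun a ha => ?_
    have ha' : a ≤ j := Nat.lt_succ_iff.1 (Finset.mem_range.1 ha)
    have e2 : j - a + (k + e - b - (j + e)) = k - (a + b) := by omega
    have h1 : ((k + e).choose (j + e) : ℝ) * ((k - j).choose b : ℝ)
        = ((k + e).choose b : ℝ) * ((k + e - b).choose (j + e) : ℝ) := by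
      exact_mod_cast choose_mul_choose_shift (e := e) hj hb'
    have h2 : ((k + e).choose b : ℝ) ≠ 0 := by
      exact_mod_cast (Nat.choose_pos (by omega)).ne'
    rw [hg, e2]
    have h3 : ((k + e - b).choose (j + e) : ℝ)
        = ((k + e).choose (j + e) : ℝ) * ((k - j).choose b : ℝ) * ((k + e).choose b : ℝ)⁻¹ := by
      rw [h1]; field_simp
    rw [h3]
    ring
  · intro b hb hb'
    simp only [Finset.mem_range] at hb hb'
    rw [Nat.choose_eq_zero_of_lt (by omega), Nat.cast_zero, zero_mul]

end ProductRules

section Combination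

variable {E : Type*} [NormedAddCommGroup E] [NormedSpace ℝ E] {H : Type*} [TopologicalSpace H]
  {I : ModelWithCorners ℝ E H} [I.Boundaryless] {k : ℕ} {M : Type*} [TopologicalSpace M]
  [ChartedSpace H M] [IsManifold I ∞ M]

lemma iterPairing_comb {e : ℕ} {p : ℕ → ℝ → E →L[ℝ] ℝ} {d : ℝ → E} {t : ℝ}
    (hp : ∀ α, ContDiffAt ℝ ∞ (p α) t) (hd : ContDiffAt ℝ ∞ d t)
    {Φ : BiVelocity I k M} {X : Velocity I.tangent k (TangentBundle I M)}
    (hΦ : ∀ a b : Fin (k + 1), Φ.fib a b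
      = ((k + e).choose b : ℝ)⁻¹ • iteratedDeriv a (p (k + e - b)) t)
    (hX : ∀ a : Fin (k + 1), X.fib a = iteratedDeriv a d t) :
    iterPairing (Φ.comb fun j => (-1) ^ j * ((k + e).choose (j + e) : ℝ)) X
      = ∑ j ∈ Finset.range (k + 1), (-1) ^ j * iteratedDeriv j
        (fun s => ∑ α ∈ Finset.range (k + e + 1),
          (α.choose (j + e) : ℝ) * p α s (iteratedDeriv (α - (j + e)) d s)) t := by
  simp only [iterPairing, BiVelocity.comb, BiVelocity.iter, _root_.sum_apply, _root_.smul_apply,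
    smul_eq_mul]
  rw [Finset.sum_comm]
  refine Finset.sum_congr rfl fun j hj => ?_
  rw [sum_iteratedDeriv_weighted hp hd (Nat.lt_succ_iff.1 (Finset.mem_range.1 hj))
      (g := fun a b => ((k + e).choose b : ℝ)⁻¹ *
        iteratedDeriv a (p (k + e - b)) t (iteratedDeriv (k - (a + b)) d t)) fun _ _ => rfl,
    ← Finset.mul_sum, mul_assoc]
  congr 2
  refine Finset.sum_congr rfl fun ε _ => ?_
  rw [hΦ, hX]
  have : εᶜ.card = k - ((ε.filter fun i : Fin k => (i : ℕ) < j).card +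
      (ε.filter fun i : Fin k => ¬ (i : ℕ) < j).card) := by
    rw [Finset.card_filter_add_card_filter_not, Finset.card_compl, Fintype.card_fin]
  simp only [this, _root_.smul_apply, smul_eq_mul]

lemma raise_apply (y : Fin (k + 1) → E →L[ℝ] ℝ) (w : Fin (k + 1) → E) :
    raise y w = ∑ α : Fin (k + 1), (k.choose α : ℝ) * y α (w α.rev) := by
  simp only [raise, _root_.sum_apply, _root_.smul_apply, ContinuousLinearMap.comp_apply,
    ContinuousLinearMap.proj_apply, smul_eq_mul]
  rw [← Equiv.sum_comp Fin.revPerm]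
  refine Finset.sum_congr rfl fun α _ => ?_
  rw [Fin.revPerm_apply, choose_rev, Fin.rev_rev]

end Combination

section Curves

variable {E : Type*} [NormedAddCommGroup E] [NormedSpace ℝ E] {H : Type*} [TopologicalSpace H]
  {I : ModelWithCorners ℝ E H} [I.Boundaryless] {k : ℕ} {M : Type*} [TopologicalSpace M]
  [ChartedSpace H M] [IsManifold I ∞ M]

variable (I) in
/-- The curve `γ` read in the preferred chart at `γ t`. -/
def chartCurve (γ : ℝ → M) (t s : ℝ) : E := extChartAt I (γ t) (γ s)

/-- The vector field `δγ` along `γ` read in the preferred trivialization at `γ t`. -/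
def fieldCurve (γ : ℝ → M) (δγ : (t : ℝ) → TangentSpace I (γ t)) (t s : ℝ) : E :=
  (trivializationAt E (TangentSpace I) (γ t) (⟨γ s, δγ s⟩ : TangentBundle I M)).2

/-- The vector field `δγ` along `γ` is of class `C^n` at `t`. -/
abbrev FieldContDiffAt (n : WithTop ℕ∞) (γ : ℝ → M) (δγ : (t : ℝ) → TangentSpace I (γ t))
    (t : ℝ) : Prop :=
  ContMDiffAt 𝓘(ℝ, ℝ) I.tangent n (fun s => (⟨γ s, δγ s⟩ : TangentBundle I M)) t

variable {γ : ℝ → M} {δγ : (t : ℝ) → TangentSpace I (γ t)} {s t : ℝ}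

lemma eventually_mem_source (hγ : ContinuousAt γ s) {x : M} (hs : γ s ∈ (extChartAt I x).source) :
    ∀ᶠ r in 𝓝 s, γ r ∈ (extChartAt I x).source :=
  hγ.eventually ((isOpen_extChartAt_source (I := I) x).mem_nhds hs)

lemma contDiffAt_chartCurve {n : WithTop ℕ∞} (hγ : ContMDiffAt 𝓘(ℝ, ℝ) I n γ t) :
    ContDiffAt ℝ n (chartCurve I γ t) t :=
  contDiffAt_extChartAt_comp hγ

lemma fieldContDiffAt_iff {n : WithTop ℕ∞} [ContMDiffVectorBundle n E (TangentSpace I : M → Type _) I]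
    (hs : γ s ∈ (extChartAt I (γ t)).source) :
    FieldContDiffAt n γ δγ s ↔
      ContMDiffAt 𝓘(ℝ, ℝ) I n γ s ∧ ContDiffAt ℝ n (fieldCurve γ δγ t) s := by
  rw [← contMDiffAt_iff_contDiffAt]
  exact (trivializationAt E (TangentSpace I : M → Type _) (γ t)).contMDiffAt_iff
    (f := fun s => (⟨γ s, δγ s⟩ : TangentBundle I M)) (by
      rw [Trivialization.mem_source]; simpa using hs)

lemma fieldCurve_smul (hs : γ s ∈ (extChartAt I (γ t)).source) (f : ℝ → ℝ) :
    fieldCurve γ (fun r => f r • δγ r) t s = f s • fieldCurve γ δγ t s :=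
  ((trivializationAt E (TangentSpace I : M → Type _) (γ t)).linear ℝ
    (by simpa using hs)).map_smul (f s) (δγ s)

lemma fieldCurve_add {η : (t : ℝ) → TangentSpace I (γ t)}
    (hs : γ s ∈ (extChartAt I (γ t)).source) :
    fieldCurve γ (fun r => δγ r + η r) t s = fieldCurve γ δγ t s + fieldCurve γ η t s :=
  ((trivializationAt E (TangentSpace I : M → Type _) (γ t)).linear ℝ
    (by simpa using hs)).map_add (δγ s) (η s)

lemma FieldContDiffAt.smul {n : WithTop ℕ∞}
    [ContMDiffVectorBundle n E (TangentSpace I : M → Type _) I]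
    (h : FieldContDiffAt n γ δγ s) {f : ℝ → ℝ} (hf : ContDiffAt ℝ n f s) :
    FieldContDiffAt n γ (fun r => f r • δγ r) s := by
  have hs : γ s ∈ (extChartAt I (γ s)).source := by simp
  rw [fieldContDiffAt_iff hs] at h ⊢
  refine ⟨h.1, (hf.smul h.2).congr_of_eventuallyEq ?_⟩
  filter_upwards [eventually_mem_source h.1.continuousAt hs] with r hr using fieldCurve_smul hr f

lemma FieldContDiffAt.add {n : WithTop ℕ∞}
    [ContMDiffVectorBundle n E (TangentSpace I : M → Type _) I]
    {η : (t : ℝ) → TangentSpace I (γ t)}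
    (h : FieldContDiffAt n γ δγ s) (h' : FieldContDiffAt n γ η s) :
    FieldContDiffAt n γ (fun r => δγ r + η r) s := by
  have hs : γ s ∈ (extChartAt I (γ s)).source := by simp
  rw [fieldContDiffAt_iff hs] at h h' ⊢
  refine ⟨h.1, (h.2.add h'.2).congr_of_eventuallyEq ?_⟩
  filter_upwards [eventually_mem_source h.1.continuousAt hs] with r hr using fieldCurve_add hr

lemma extChartAt_tangent_field_eventuallyEq (hγ : ContinuousAt γ s) {z : TangentBundle I M}
    (hz : z.proj = γ t) (hs : γ s ∈ (extChartAt I (γ t)).source) :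
    (fun r => extChartAt I.tangent z (⟨γ r, δγ r⟩ : TangentBundle I M)) =ᶠ[𝓝 s]
      fun r => (chartCurve I γ t r, fieldCurve γ δγ t r) := by
  filter_upwards [eventually_mem_source hγ hs] with r hr
  rw [extChartAt_totalSpace_apply (mem_extChartAt_tangent_source.2 (by rwa [hz])), hz]
  rfl

/-- The variation generated by a vector field consists of the derivatives of the field. -/
lemma variation_eq (h : FieldContDiffAt k γ δγ t) :
    variation k γ δγ t
      = ⟨prolong I k γ t, fun α => iteratedDeriv α (fieldCurve γ δγ t) t⟩ := by
  have hs : γ t ∈ (extChartAt I (γ t)).source := by simp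
  have hev := extChartAt_tangent_field_eventuallyEq (δγ := δγ) (z := ⟨γ t, δγ t⟩) (t := t)
    (contMDiffAt_totalSpace.1 h).1.continuousAt rfl hs
  have hc := contDiffAt_extChartAt_comp h
  have hd : ∀ α : Fin (k + 1), (prolong I.tangent k
      (fun s => (⟨γ s, δγ s⟩ : TangentBundle I M)) t).coord α
      = iteratedDeriv α (fun r => (chartCurve I γ t r, fieldCurve γ δγ t r)) t := fun α => by
    rw [← hev.iteratedDeriv_eq]
    refine Fin.cases ?_ (fun i => rfl) α
    simp [prolong]
  have hcd : ContDiffAt ℝ k (fun r => (chartCurve I γ t r, fieldCurve γ δγ t r)) t :=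
    hc.congr_of_eventuallyEq hev.symm
  have hle : ∀ α : Fin (k + 1), ((α : ℕ) : WithTop ℕ∞) ≤ k := fun α => by
    exact_mod_cast Nat.lt_succ_iff.1 α.2
  have h1 : (prolong I.tangent k (fun s => (⟨γ s, δγ s⟩ : TangentBundle I M)) t).mapProj
      = prolong I k γ t := by
    refine Velocity.ext rfl (funext fun i => ?_)
    have := congrArg Prod.fst (hd i.succ)
    rw [iteratedDeriv_fst (hcd.of_le (hle i.succ))] at this
    exact this
  have h2 : (prolong I.tangent k (fun s => (⟨γ s, δγ s⟩ : TangentBundle I M)) t).fib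
      = fun α : Fin (k + 1) => iteratedDeriv α (fieldCurve γ δγ t) t := by
    funext α
    have := congrArg Prod.snd (hd α)
    rw [iteratedDeriv_snd (hcd.of_le (hle α))] at this
    exact this
  change (⟨_, _⟩ : TangentBundle 𝓘(ℝ, Fin (k + 1) → E) (Velocity I k M)) = _
  rw [h1, h2]

/-- The differential of `L` along `j^k γ` in the adapted coordinates that come from the preferred
chart at `γ t`. -/
def jetDifferential (L : Velocity I k M → ℝ) (γ : ℝ → M) (t s : ℝ) : (Fin (k + 1) → E) →L[ℝ] ℝ :=
  fderiv ℝ (L ∘ (velocityChart I k (γ t)).symm) fun α => iteratedDeriv α (chartCurve I γ t) s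

/-- The partial derivatives `∂L/∂x^{(α)}` along `j^k γ`. -/
def jetCoeff (L : Velocity I k M → ℝ) (γ : ℝ → M) (t : ℝ) (α : ℕ) (s : ℝ) : E →L[ℝ] ℝ :=
  if h : α < k + 1 then
    jetDifferential L γ t s ∘L ContinuousLinearMap.single ℝ (fun _ => E) ⟨α, h⟩ else 0

lemma jetDifferential_apply (L : Velocity I k M → ℝ) (γ : ℝ → M) (t s : ℝ) (u : ℕ → E) :
    jetDifferential L γ t s (fun α => u α)
      = ∑ α ∈ Finset.range (k + 1), jetCoeff L γ t α s (u α) := by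
  rw [Finset.sum_range, ← Finset.univ_sum_single (fun α : Fin (k + 1) => u α), map_sum]
  refine Finset.sum_congr rfl fun α _ => ?_
  rw [jetCoeff, dif_pos α.2]
  rfl

lemma mfderiv_variation {L : Velocity I k M → ℝ}
    (hL : ContMDiff 𝓘(ℝ, Fin (k + 1) → E) 𝓘(ℝ, ℝ) ∞ L) (h : FieldContDiffAt k γ δγ s)
    (hs : γ s ∈ (extChartAt I (γ t)).source) :
    mfderiv 𝓘(ℝ, Fin (k + 1) → E) 𝓘(ℝ, ℝ) L (variation k γ δγ s).proj (variation k γ δγ s).2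
      = ∑ α ∈ Finset.range (k + 1), jetCoeff L γ t α s (iteratedDeriv α (fieldCurve γ δγ t) s) := by
  set z : TangentBundle I M := ⟨γ t, 0⟩ with hz
  set X := prolong I.tangent k (fun s => (⟨γ s, δγ s⟩ : TangentBundle I M)) s with hX
  have hXs : X.base.proj ∈ (extChartAt I z.proj).source := hs
  have hXs' : X.base ∈ (extChartAt I.tangent z).source := mem_extChartAt_tangent_source.2 hXs
  have hev := extChartAt_tangent_field_eventuallyEq (δγ := δγ) (z := z) (t := t)
    (contMDiffAt_totalSpace.1 h).1.continuousAt rfl hs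
  have hchart : ∀ α : Fin (k + 1), velocityChart I.tangent k z X α
      = iteratedDeriv α (fun r => (chartCurve I γ t r, fieldCurve γ δγ t r)) s := fun α => by
    rw [hX, velocityChart_prolong_of_contMDiffAt h hXs', hev.iteratedDeriv_eq]
  have hcd : ContDiffAt ℝ k (fun r => (chartCurve I γ t r, fieldCurve γ δγ t r)) s := by
    refine ContDiffAt.congr_of_eventuallyEq ?_ hev.symm
    have h3 := contMDiffAt_extChartAt' (I := I.tangent) (n := k) (x := z)
      (x' := (⟨γ s, δγ s⟩ : TangentBundle I M)) (by simpa using hs)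
    exact (h3.comp s h).contDiffAt
  have hle : ∀ α : Fin (k + 1), ((α : ℕ) : WithTop ℕ∞) ≤ k := fun α => by
    exact_mod_cast Nat.lt_succ_iff.1 α.2
  have h1 : velocityChart I k (γ t) X.mapProj = fun α : Fin (k + 1) =>
      iteratedDeriv α (chartCurve I γ t) s := funext fun α => by
    rw [← iteratedDeriv_fst (hcd.of_le (hle α)), ← hchart]
    exact (velocityChart_fst hXs' α).symm
  have h2 : (fun α => (velocityChart I.tangent k z X α).2) = fun α : Fin (k + 1) =>
      iteratedDeriv α (fieldCurve γ δγ t) s := funext fun α => by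
    rw [← iteratedDeriv_snd (hcd.of_le (hle α)), ← hchart]
  refine (mfderiv_canonicalFlip hL hXs).trans ?_
  rw [h2]
  change fderiv ℝ (L ∘ (velocityChart I k (γ t)).symm) (velocityChart I k (γ t) X.mapProj) _ = _
  rw [h1]
  exact jetDifferential_apply L γ t s fun α => iteratedDeriv α (fieldCurve γ δγ t) s

lemma contDiffAt_jetCoeff {L : Velocity I k M → ℝ}
    (hL : ContMDiff 𝓘(ℝ, Fin (k + 1) → E) 𝓘(ℝ, ℝ) ∞ L) (hγ : ContMDiffAt 𝓘(ℝ, ℝ) I ∞ γ t)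
    (α : ℕ) : ContDiffAt ℝ ∞ (jetCoeff L γ t α) t := by
  have h1 : ContDiffAt ℝ ∞ (fun s => fun α : Fin (k + 1) =>
      iteratedDeriv α (chartCurve I γ t) s) t :=
    contDiffAt_pi.2 fun α => contDiffAt_iteratedDeriv (contDiffAt_chartCurve hγ) α
  have h2 : ContDiffAt ℝ ∞ (jetDifferential L γ t) t := by
    refine ContDiffAt.comp t (g := fderiv ℝ (L ∘ (velocityChart I k (γ t)).symm))
      (ContDiffAt.fderiv_right (m := ∞) (n := ∞) (contDiffAt_comp_velocityChart_symm hL ?_)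
        (by simp)) h1
    simp [chartCurve]
  unfold jetCoeff
  split_ifs with h
  · exact h2.clm_comp contDiffAt_const
  · exact contDiffAt_const

/-- The derivative of `L` along the variation at `s` generated by the product of `δγ` with the Taylor
monomial `(r - s)^m / m!`. -/
def weightedAction (L : Velocity I k M → ℝ) (γ : ℝ → M) (δγ : (t : ℝ) → TangentSpace I (γ t))
    (m : ℕ) (s : ℝ) : ℝ :=
  let δ := variation k γ (fun r => ((r - s) ^ m / (m.factorial : ℝ)) • δγ r) s
  mfderiv 𝓘(ℝ, Fin (k + 1) → E) 𝓘(ℝ, ℝ) L δ.proj δ.2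

lemma weightedAction_eventuallyEq {L : Velocity I k M → ℝ}
    (hL : ContMDiff 𝓘(ℝ, Fin (k + 1) → E) 𝓘(ℝ, ℝ) ∞ L) (h : FieldContDiffAt ∞ γ δγ t) (m : ℕ) :
    weightedAction L γ δγ m =ᶠ[𝓝 t] fun s => ∑ α ∈ Finset.range (k + 1),
      (α.choose m : ℝ) * jetCoeff L γ t α s (iteratedDeriv (α - m) (fieldCurve γ δγ t) s) := by
  have hk : FieldContDiffAt k γ δγ t := h.of_le ENat.LEInfty.out
  have h1 : ∀ᶠ s in 𝓝 t, FieldContDiffAt k γ δγ s :=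
    (contMDiffAt_iff_contMDiffAt_nhds (by simp)).1 hk
  have hγ := (contMDiffAt_totalSpace.1 h).1.continuousAt
  filter_upwards [h1, eventually_mem_source (I := I) hγ (x := γ t) (by simp)] with s hs hsrc
  have hd : ContDiffAt ℝ k (fieldCurve γ δγ t) s := ((fieldContDiffAt_iff hsrc).1 hs).2
  have hw : FieldContDiffAt k γ (fun r => ((r - s) ^ m / (m.factorial : ℝ)) • δγ r) s :=
    hs.smul (by fun_prop)
  refine (mfderiv_variation hL hw hsrc).trans ?_
  refine Finset.sum_congr rfl fun α hα => ?_
  have hle : ((α : ℕ) : WithTop ℕ∞) ≤ k := by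
    exact_mod_cast Nat.lt_succ_iff.1 (Finset.mem_range.1 hα)
  have hev : fieldCurve γ (fun r => ((r - s) ^ m / (m.factorial : ℝ)) • δγ r) t =ᶠ[𝓝 s]
      fun r => ((r - s) ^ m / (m.factorial : ℝ)) • fieldCurve γ δγ t r := by
    filter_upwards [eventually_mem_source (contMDiffAt_totalSpace.1 hs).1.continuousAt hsrc]
      with r hr using fieldCurve_smul hr _
  rw [hev.iteratedDeriv_eq, iteratedDeriv_taylor_smul (hd.of_le hle), map_smul, smul_eq_mul]

lemma contDiffAt_fieldCurve (h : FieldContDiffAt ∞ γ δγ t) :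
    ContDiffAt ℝ ∞ (fieldCurve γ δγ t) t :=
  ((fieldContDiffAt_iff (by simp)).1 h).2

lemma contDiffAt_weightedAction {L : Velocity I k M → ℝ}
    (hL : ContMDiff 𝓘(ℝ, Fin (k + 1) → E) 𝓘(ℝ, ℝ) ∞ L) (h : FieldContDiffAt ∞ γ δγ t) (m : ℕ) :
    ContDiffAt ℝ ∞ (weightedAction L γ δγ m) t := by
  refine ContDiffAt.congr_of_eventuallyEq ?_ (weightedAction_eventuallyEq hL h m)
  exact ContDiffAt.sum fun α _ => contDiffAt_const.mul
    ((contDiffAt_jetCoeff hL (contMDiffAt_totalSpace.1 h).1 α).clm_apply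
      (contDiffAt_iteratedDeriv (contDiffAt_fieldCurve h) _))

end Curves

section ForceMomentum

variable {E : Type*} [NormedAddCommGroup E] [NormedSpace ℝ E] {H : Type*} [TopologicalSpace H]
  {I : ModelWithCorners ℝ E H} [I.Boundaryless] {k : ℕ} {M : Type*} [TopologicalSpace M]
  [ChartedSpace H M] [IsManifold I ∞ M]
  {γ : ℝ → M} {δγ : (t : ℝ) → TangentSpace I (γ t)} {t : ℝ}

lemma biVelocity_fib_prolong
    {Λ : ℝ → Velocity (I.prod 𝓘(ℝ, E →L[ℝ] ℝ)) k (CotangentBundle I M)}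
    {f : ℝ → Fin (k + 1) → E × (E →L[ℝ] ℝ)} (hf : ContDiffAt ℝ ∞ f t)
    (hΛ : (fun s => velocityChart (I.prod 𝓘(ℝ, E →L[ℝ] ℝ)) k (Λ t).base (Λ s)) =ᶠ[𝓝 t] f)
    (a b : Fin (k + 1)) :
    BiVelocity.fib (prolong 𝓘(ℝ, Fin (k + 1) → E × (E →L[ℝ] ℝ)) k Λ t) a b
      = iteratedDeriv a (fun s => (f s b).2) t := by
  have h1 : (prolong 𝓘(ℝ, Fin (k + 1) → E × (E →L[ℝ] ℝ)) k Λ t).coord a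
      = iteratedDeriv a f t := by
    rw [← hΛ.iteratedDeriv_eq]
    refine Fin.cases ?_ (fun i => rfl) a
    rfl
  have hle : ((a : ℕ) : WithTop ℕ∞) ≤ ∞ := ENat.LEInfty.out
  rw [BiVelocity.fib, h1, iteratedDeriv_apply (hf.of_le hle), iteratedDeriv_snd]
  exact (contDiffAt_pi.1 hf b).of_le hle

lemma lower_jetDifferential (L : Velocity I k M → ℝ) (γ : ℝ → M) (t s : ℝ) (b : Fin (k + 1)) :
    lower (jetDifferential L γ t s) b = (k.choose b : ℝ)⁻¹ • jetCoeff L γ t (k - b) s := by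
  have h : k - (b : ℕ) < k + 1 := by omega
  have h' : b.rev = ⟨k - b, h⟩ := by
    ext; simp [Fin.val_rev]
  rw [lower, jetCoeff, dif_pos h, h']

lemma velocityChart_bigLambda_prolong {L : Velocity I k M → ℝ}
    (hL : ContMDiff 𝓘(ℝ, Fin (k + 1) → E) 𝓘(ℝ, ℝ) ∞ L) (hγ : ContMDiffAt 𝓘(ℝ, ℝ) I ∞ γ t)
    {ζ : CotangentBundle I M} (hζ : ζ.proj = γ t) :
    ∀ᶠ s in 𝓝 t, ∀ b : Fin (k + 1), velocityChart (I.prod 𝓘(ℝ, E →L[ℝ] ℝ)) k ζ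
      (bigLambda L (prolong I k γ s)) b = (iteratedDeriv b (chartCurve I γ t) s,
        (k.choose b : ℝ)⁻¹ • jetCoeff L γ t (k - b) s) := by
  have hk : ContMDiffAt 𝓘(ℝ, ℝ) I k γ t := hγ.of_le ENat.LEInfty.out
  filter_upwards [(contMDiffAt_iff_contMDiffAt_nhds (by simp)).1 hk,
    eventually_mem_source (I := I) hγ.continuousAt (x := γ t) (by simp)] with s hs hsrc b
  have h1 : velocityChart I k ζ.proj (prolong I k γ s)
      = fun α : Fin (k + 1) => iteratedDeriv α (chartCurve I γ t) s := funext fun α => by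
    rw [hζ, velocityChart_prolong_of_contMDiffAt hs hsrc]
    rfl
  rw [velocityChart_bigLambda hL (by rw [hζ]; exact hsrc), h1, ← lower_jetDifferential, hζ]
  rfl

lemma contDiffAt_bigLambda_coord {L : Velocity I k M → ℝ}
    (hL : ContMDiff 𝓘(ℝ, Fin (k + 1) → E) 𝓘(ℝ, ℝ) ∞ L) (hγ : ContMDiffAt 𝓘(ℝ, ℝ) I ∞ γ t)
    (b : ℕ) : ContDiffAt ℝ ∞ (fun s => (iteratedDeriv b (chartCurve I γ t) s,
        (k.choose b : ℝ)⁻¹ • jetCoeff L γ t (k - b) s)) t :=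
  (contDiffAt_iteratedDeriv (contDiffAt_chartCurve hγ) b).prodMk
    ((contDiffAt_jetCoeff hL hγ _).const_smul _)

lemma iteratedDeriv_bigLambda_coord_snd (L : Velocity I k M → ℝ) (γ : ℝ → M) (t : ℝ) (a b : ℕ) :
    iteratedDeriv a (fun s => (k.choose b : ℝ)⁻¹ • jetCoeff L γ t (k - b) s) t
      = (k.choose b : ℝ)⁻¹ • iteratedDeriv a (jetCoeff L γ t (k - b)) t :=
  iteratedDeriv_fun_const_smul_field _ _

/-- The coordinate expression of the force. -/
def forceCoeff (L : Velocity I k M → ℝ) (γ : ℝ → M) (t : ℝ) : E →L[ℝ] ℝ :=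
  (BiVelocity.tilde (prolong 𝓘(ℝ, Fin (k + 1) → E × (E →L[ℝ] ℝ)) k
    (fun s => bigLambda L (prolong I k γ s)) t)).coord Finset.univ

lemma force_eq_zero_iff (L : Velocity I k M → ℝ) (γ : ℝ → M) (t : ℝ) :
    force L γ t = ⟨γ t, 0⟩ ↔ forceCoeff L γ t = 0 := by
  set e := trivializationAt (E →L[ℝ] ℝ) (fun x : M => TangentSpace I x →L[ℝ] ℝ) (γ t) with he
  have hb : γ t ∈ e.baseSet := mem_baseSet_trivializationAt _ _ _
  have h0 : force L γ t = ⟨γ t, e.symm (γ t) (forceCoeff L γ t)⟩ := rfl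
  have h1 : (e ⟨γ t, e.symm (γ t) (forceCoeff L γ t)⟩).2 = forceCoeff L γ t := by
    rw [e.apply_mk_symm hb]
  have h2 : (e ⟨γ t, 0⟩).2 = 0 := (e.linear ℝ hb).map_zero
  rw [h0]
  constructor
  · intro h
    rw [← h1, h, h2]
  · intro h
    have h3 : e.symm (γ t) (forceCoeff L γ t) = 0 := by
      rw [h, ← h2]
      exact e.symm_apply_apply_mk hb 0
    rw [h3]

lemma fib_prolong_field (h : FieldContDiffAt k γ δγ t) :
    (prolong I.tangent k (fun s => (⟨γ s, δγ s⟩ : TangentBundle I M)) t).fib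
      = fun α : Fin (k + 1) => iteratedDeriv α (fieldCurve γ δγ t) t := by
  have h1 := variation_eq h
  have h2 : HEq (variation k γ δγ t).2 _ := (TotalSpace.ext_iff.1 h1).2
  exact eq_of_heq h2

lemma iteratedDeriv_weightedAction {L : Velocity I k M → ℝ}
    (hL : ContMDiff 𝓘(ℝ, Fin (k + 1) → E) 𝓘(ℝ, ℝ) ∞ L) (h : FieldContDiffAt ∞ γ δγ t) (j m : ℕ) :
    iteratedDeriv j (weightedAction L γ δγ m) t = iteratedDeriv j (fun s =>
      ∑ α ∈ Finset.range (k + 1), (α.choose m : ℝ) *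
        jetCoeff L γ t α s (iteratedDeriv (α - m) (fieldCurve γ δγ t) s)) t :=
  (weightedAction_eventuallyEq hL h m).iteratedDeriv_eq j

/-- The pairing of the force with a vector field along the curve. -/
lemma forceCoeff_apply {L : Velocity I k M → ℝ}
    (hL : ContMDiff 𝓘(ℝ, Fin (k + 1) → E) 𝓘(ℝ, ℝ) ∞ L) (h : FieldContDiffAt ∞ γ δγ t) :
    forceCoeff L γ t (fieldCurve γ δγ t t) = ∑ j ∈ Finset.range (k + 1),
      (-1) ^ j * iteratedDeriv j (weightedAction L γ δγ j) t := by
  have hγ : ContMDiffAt 𝓘(ℝ, ℝ) I ∞ γ t := (contMDiffAt_totalSpace.1 h).1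
  have hfib := fib_prolong_field (h.of_le (ENat.LEInfty.out : (k : WithTop ℕ∞) ≤ ∞))
  set X := prolong I.tangent k (fun s => (⟨γ s, δγ s⟩ : TangentBundle I M)) t with hX
  have h0 : X.fib 0 = fieldCurve γ δγ t t := by
    rw [hfib]; simp
  rw [forceCoeff, ← h0, ← iterPairing_tilde]
  have key := iterPairing_comb (e := 0) (p := jetCoeff L γ t)
    (d := fieldCurve γ δγ t) (fun α => contDiffAt_jetCoeff hL hγ α) (contDiffAt_fieldCurve h)
    (Φ := prolong 𝓘(ℝ, Fin (k + 1) → E × (E →L[ℝ] ℝ)) k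
      (fun s => bigLambda L (prolong I k γ s)) t) (X := X) (fun a b => ?_)
    (fun a => by rw [hfib])
  · refine key.trans (Finset.sum_congr rfl fun j _ => ?_)
    rw [iteratedDeriv_weightedAction hL h]
    rfl
  · have hev := velocityChart_bigLambda_prolong hL hγ
      (ζ := (bigLambda L (prolong I k γ t)).base) rfl
    rw [biVelocity_fib_prolong (f := fun s b => (iteratedDeriv b (chartCurve I γ t) s,
      (k.choose b : ℝ)⁻¹ • jetCoeff L γ t (k - b) s)) ?_ ?_]
    · exact iteratedDeriv_bigLambda_coord_snd L γ t a b
    · exact contDiffAt_pi.2 fun b => contDiffAt_bigLambda_coord hL hγ b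
    · filter_upwards [hev] with s hs
      exact funext hs

/-- The coordinate expression of the momentum, as a covector. -/
def momentumCoeff (L : Velocity I (k + 1) M → ℝ) (γ : ℝ → M) (t : ℝ) : (Fin (k + 1) → E) →L[ℝ] ℝ :=
  raise (momentum L γ t).fib

lemma dualFlip_symm_momentum (L : Velocity I (k + 1) M → ℝ) (γ : ℝ → M) (t : ℝ) :
    dualFlip.symm (momentum L γ t) = ⟨prolong I k γ t, momentumCoeff L γ t⟩ :=
  rfl

/-- The pairing of the momentum with a variation. -/
lemma momentumCoeff_apply {L : Velocity I (k + 1) M → ℝ}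
    (hL : ContMDiff 𝓘(ℝ, Fin (k + 1 + 1) → E) 𝓘(ℝ, ℝ) ∞ L) (h : FieldContDiffAt ∞ γ δγ t) :
    momentumCoeff L γ t (fun α => iteratedDeriv α (fieldCurve γ δγ t) t)
      = ∑ j ∈ Finset.range (k + 1),
        (-1) ^ j * iteratedDeriv j (weightedAction L γ δγ (j + 1)) t := by
  have hγ : ContMDiffAt 𝓘(ℝ, ℝ) I ∞ γ t := (contMDiffAt_totalSpace.1 h).1
  have hfib := fib_prolong_field (h.of_le (ENat.LEInfty.out : (k : WithTop ℕ∞) ≤ ∞))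
  set X := prolong I.tangent k (fun s => (⟨γ s, δγ s⟩ : TangentBundle I M)) t with hX
  have h1 : momentumCoeff L γ t X.fib = pairing (momentum L γ t) X := raise_apply _ _
  rw [← hfib, h1, momentum, momenta, pairing_holProj]
  have key := iterPairing_comb (e := 1) (p := jetCoeff L γ t)
    (d := fieldCurve γ δγ t) (fun α => contDiffAt_jetCoeff hL hγ α) (contDiffAt_fieldCurve h)
    (Φ := prolong 𝓘(ℝ, Fin (k + 1) → E × (E →L[ℝ] ℝ)) k
      (fun s => smallLambda L (prolong I (k + 1) γ s)) t) (X := X) (fun a b => ?_)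
    (fun a => by rw [hfib])
  · refine key.trans (Finset.sum_congr rfl fun j _ => ?_)
    rw [iteratedDeriv_weightedAction hL h]
  · have hev := velocityChart_bigLambda_prolong hL hγ
      (ζ := (smallLambda L (prolong I (k + 1) γ t)).base) rfl
    rw [biVelocity_fib_prolong (f := fun s b => (iteratedDeriv b (chartCurve I γ t) s,
      ((k + 1).choose b : ℝ)⁻¹ • jetCoeff L γ t (k + 1 - b) s)) ?_ ?_]
    · exact iteratedDeriv_bigLambda_coord_snd L γ t a b
    · exact contDiffAt_pi.2 fun b => contDiffAt_bigLambda_coord hL hγ b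
    · filter_upwards [hev,
        eventually_mem_source (I := I) hγ.continuousAt (x := γ t) (by simp)] with s hs hsrc
      funext b
      refine (velocityChart_truncate ?_ b).trans (hs b.castSucc)
      exact mem_extChartAt_cotangent_source hsrc

end ForceMomentum

section FirstVariation

variable {E : Type*} [NormedAddCommGroup E] [NormedSpace ℝ E] {H : Type*} [TopologicalSpace H]
  {I : ModelWithCorners ℝ E H} [I.Boundaryless] {k : ℕ} {M : Type*} [TopologicalSpace M]
  [ChartedSpace H M] [IsManifold I ∞ M]
  {γ : ℝ → M} {δγ : (t : ℝ) → TangentSpace I (γ t)} {t₀ t₁ : ℝ}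

lemma actionDifferential_eq_integral_weightedAction (L : Velocity I k M → ℝ)
    (δγ : (t : ℝ) → TangentSpace I (γ t)) (t₀ t₁ : ℝ) :
    actionDifferential L t₀ t₁ (variation k γ δγ) = ∫ t in t₀..t₁, weightedAction L γ δγ 0 t := by
  have h : ∀ t : ℝ, (fun r => ((r - t) ^ 0 / ((Nat.factorial 0 : ℕ) : ℝ)) • δγ r) = δγ :=
    fun t => funext fun r => by
      rw [pow_zero, Nat.factorial_zero, Nat.cast_one, div_one, one_smul]
  refine intervalIntegral.integral_congr fun t _ => ?_
  exact congrArg (fun η : (t : ℝ) → TangentSpace I (γ t) =>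
    (mfderiv 𝓘(ℝ, Fin (k + 1) → E) 𝓘(ℝ, ℝ) L (variation k γ η t).proj (variation k γ η t).2 : ℝ))
    (h t).symm

lemma continuousOn_sum_weightedAction {L : Velocity I k M → ℝ}
    (hL : ContMDiff 𝓘(ℝ, Fin (k + 1) → E) 𝓘(ℝ, ℝ) ∞ L)
    (h : ∀ t ∈ Icc t₀ t₁, FieldContDiffAt ∞ γ δγ t) :
    ContinuousOn (fun t => ∑ j ∈ Finset.range (k + 1),
      (-1) ^ j * iteratedDeriv j (weightedAction L γ δγ j) t) (Icc t₀ t₁) := by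
  intro t ht
  refine ContinuousAt.continuousWithinAt (ContDiffAt.continuousAt (𝕜 := ℝ) (n := ∞) ?_)
  exact ContDiffAt.sum fun j _ => contDiffAt_const.mul
    (contDiffAt_iteratedDeriv (contDiffAt_weightedAction hL (h t ht) j) j)

/-- The first variation formula. -/
lemma actionDifferential_eq {L : Velocity I (k + 1) M → ℝ}
    (hL : ContMDiff 𝓘(ℝ, Fin (k + 1 + 1) → E) 𝓘(ℝ, ℝ) ∞ L) (ht : t₀ ≤ t₁)
    (h : ∀ t ∈ Icc t₀ t₁, FieldContDiffAt ∞ γ δγ t) :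
    actionDifferential L t₀ t₁ (variation (k + 1) γ δγ)
      = (∫ t in t₀..t₁, forceCoeff L γ t (fieldCurve γ δγ t t))
        + momentumCoeff L γ t₁ (fun α => iteratedDeriv α (fieldCurve γ δγ t₁) t₁)
        - momentumCoeff L γ t₀ (fun α => iteratedDeriv α (fieldCurve γ δγ t₀) t₀) := by
  have hQ : ∀ t ∈ Icc t₀ t₁, ∀ j m, ContDiffAt ℝ ∞ (iteratedDeriv j (weightedAction L γ δγ m)) t :=
    fun t ht j m => contDiffAt_iteratedDeriv (contDiffAt_weightedAction hL (h t ht) m) j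
  set g : ℝ → ℝ := fun t => ∑ j ∈ Finset.range (k + 1),
    (-1) ^ j * iteratedDeriv j (weightedAction L γ δγ (j + 1)) t with hg
  set g' : ℝ → ℝ := fun t => ∑ j ∈ Finset.range (k + 1),
    (-1) ^ j * iteratedDeriv (j + 1) (weightedAction L γ δγ (j + 1)) t with hg'
  have hu : uIcc t₀ t₁ = Icc t₀ t₁ := uIcc_of_le ht
  have hder : ∀ t ∈ uIcc t₀ t₁, HasDerivAt g (g' t) t := by
    intro t ht'
    rw [hu] at ht'
    refine HasDerivAt.fun_sum fun j _ => ?_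
    rw [iteratedDeriv_succ]
    exact ((hQ t ht' j (j + 1)).differentiableAt (by simp)).hasDerivAt.const_mul _
  have hcont : ContinuousOn g' (Icc t₀ t₁) := by
    intro t ht'
    refine ContinuousAt.continuousWithinAt (ContDiffAt.continuousAt (𝕜 := ℝ) (n := ∞) ?_)
    exact ContDiffAt.sum fun j _ => contDiffAt_const.mul (hQ t ht' (j + 1) (j + 1))
  have hint : IntervalIntegrable g' volume t₀ t₁ :=
    ContinuousOn.intervalIntegrable (by rwa [hu])
  have hsplit : ∀ t, ∑ j ∈ Finset.range (k + 1 + 1),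
      (-1) ^ j * iteratedDeriv j (weightedAction L γ δγ j) t
      = weightedAction L γ δγ 0 t - g' t := fun t => by
    rw [Finset.sum_range_succ', hg']
    simp only [pow_zero, one_mul, iteratedDeriv_zero, pow_succ, mul_neg, mul_one, neg_mul,
      Finset.sum_neg_distrib]
    ring
  have hF : ∫ t in t₀..t₁, forceCoeff L γ t (fieldCurve γ δγ t t)
      = ∫ t in t₀..t₁, (weightedAction L γ δγ 0 t - g' t) := by
    refine intervalIntegral.integral_congr fun t ht' => ?_
    rw [hu] at ht'
    rw [forceCoeff_apply hL (h t ht'), hsplit]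
  have hint0 : IntervalIntegrable (weightedAction L γ δγ 0) volume t₀ t₁ := by
    refine ContinuousOn.intervalIntegrable ?_
    rw [hu]
    exact fun t ht' => (contDiffAt_weightedAction hL (h t ht') 0).continuousAt.continuousWithinAt
  rw [actionDifferential_eq_integral_weightedAction, hF, intervalIntegral.integral_sub hint0 hint,
    intervalIntegral.integral_eq_sub_of_hasDerivAt hder hint,
    momentumCoeff_apply hL (h t₁ (right_mem_Icc.2 ht)),
    momentumCoeff_apply hL (h t₀ (left_mem_Icc.2 ht))]
  ring

lemma fieldCurve_zero {t s : ℝ} (hs : γ s ∈ (extChartAt I (γ t)).source) (h0 : δγ s = 0) :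
    fieldCurve γ δγ t s = 0 := by
  rw [fieldCurve, h0]
  exact ((trivializationAt E (TangentSpace I : M → Type _) (γ t)).linear ℝ
    (by simpa using hs)).map_zero

lemma fieldCurve_eventuallyEq_zero {s : ℝ} (hγ : ContinuousAt γ s)
    (h0 : ∀ᶠ r in 𝓝 s, δγ r = 0) : fieldCurve γ δγ s =ᶠ[𝓝 s] 0 := by
  filter_upwards [h0, eventually_mem_source (I := I) hγ (x := γ s) (by simp)] with r h1 h2
  exact fieldCurve_zero h2 h1

lemma iteratedDeriv_fieldCurve_eq_zero {s : ℝ} (hγ : ContinuousAt γ s)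
    (h0 : ∀ᶠ r in 𝓝 s, δγ r = 0) (n : ℕ) : iteratedDeriv n (fieldCurve γ δγ s) s = 0 := by
  rw [(fieldCurve_eventuallyEq_zero hγ h0).iteratedDeriv_eq]
  simp

/-- Vector fields along a curve with a prescribed germ at a point and a small support. -/
lemma exists_field_germ (hγ : ∀ s ∈ Icc t₀ t₁, ContMDiffAt 𝓘(ℝ, ℝ) I ∞ γ s) {t : ℝ}
    (ht : t ∈ Icc t₀ t₁) {f : ℝ → E} (hf : ContDiff ℝ ∞ f) {U : Set ℝ} (hU : U ∈ 𝓝 t) :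
    ∃ δγ : (s : ℝ) → TangentSpace I (γ s), (∀ s ∈ Icc t₀ t₁, FieldContDiffAt ∞ γ δγ s) ∧
      fieldCurve γ δγ t =ᶠ[𝓝 t] f ∧ ∀ s ∉ U, δγ s = 0 := by
  obtain ⟨ε, hε, hball⟩ := Metric.nhds_basis_closedBall.mem_iff.1 (inter_mem hU
    (eventually_mem_source (I := I) (hγ t ht).continuousAt (x := γ t) (by simp)))
  let χ : ContDiffBump t := ⟨ε / 2, ε, by positivity, by linarith⟩
  set e := trivializationAt E (TangentSpace I : M → Type _) (γ t) with he
  set δγ : (s : ℝ) → TangentSpace I (γ s) := fun s => χ s • e.symm (γ s) (f s) with hδ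
  have hval : ∀ s, γ s ∈ (extChartAt I (γ t)).source → fieldCurve γ δγ t s = χ s • f s := by
    intro s hs
    have hb : γ s ∈ e.baseSet := by rw [he]; simpa using hs
    rw [hδ, fieldCurve_smul hs, fieldCurve, e.apply_mk_symm hb]
  have hzero : ∀ s ∉ Metric.ball t ε, δγ s = 0 := by
    intro s hs
    have : χ s = 0 := by
      rw [← Function.notMem_support, χ.support_eq]
      exact hs
    rw [hδ]
    simp only [this, zero_smul]
  refine ⟨δγ, fun s hs => ?_, ?_, fun s hs => hzero s fun h =>
    hs (hball (Metric.ball_subset_closedBall h)).1⟩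
  · by_cases hst : s ∈ Metric.closedBall t ε
    · have hsrc := (hball hst).2
      rw [fieldContDiffAt_iff hsrc]
      refine ⟨hγ s hs, (χ.contDiffAt.smul hf.contDiffAt).congr_of_eventuallyEq ?_⟩
      filter_upwards [eventually_mem_source (I := I) (hγ s hs).continuousAt hsrc] with r hr
        using hval r hr
    · have h1 : ∀ᶠ r in 𝓝 s, δγ r = 0 := by
        filter_upwards [Metric.isClosed_closedBall.isOpen_compl.mem_nhds hst] with r hr
        exact hzero r fun h => hr (Metric.ball_subset_closedBall h)
      rw [fieldContDiffAt_iff (t := s) (by simp)]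
      exact ⟨hγ s hs, contDiffAt_const.congr_of_eventuallyEq
        (fieldCurve_eventuallyEq_zero (hγ s hs).continuousAt h1)⟩
  · filter_upwards [χ.eventuallyEq_one, Metric.closedBall_mem_nhds t hε] with s h1 h2
    rw [hval s (hball h2).2, h1, Pi.one_apply, one_smul]

lemma iteratedDeriv_jetPoly_sub (u : Fin (k + 1) → E) (t : ℝ) (α : Fin (k + 1)) :
    iteratedDeriv α (fun s => jetPoly u (s - t)) t = u α := by
  rw [iteratedDeriv_comp_sub_const (f := jetPoly u)]
  simpa using iteratedDeriv_jetPoly u α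

variable {E' : Type*} [NormedAddCommGroup E'] [NormedSpace ℝ E'] {H' : Type*} [TopologicalSpace H']
  {J : ModelWithCorners ℝ E' H'} {N : Type*} [TopologicalSpace N] [ChartedSpace H' N]

lemma zero_mem_tangentSet {i : N → Velocity I k M × Velocity I k M} {a b : Velocity I k M}
    (hab : (a, b) ∈ range i) :
    ((⟨a, 0⟩, ⟨b, 0⟩) : TangentBundle 𝓘(ℝ, Fin (k + 1) → E) (Velocity I k M) ×
      TangentBundle 𝓘(ℝ, Fin (k + 1) → E) (Velocity I k M)) ∈ tangentSet J i := by
  obtain ⟨n, hn⟩ := hab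
  refine ⟨⟨n, 0⟩, ?_⟩
  simp only [tangentMap, map_zero]
  rw [hn]
  rfl

end FirstVariation

section EulerLagrange

variable {E : Type*} [NormedAddCommGroup E] [NormedSpace ℝ E] {H : Type*} [TopologicalSpace H]
  {I : ModelWithCorners ℝ E H} [I.Boundaryless] {k : ℕ} {M : Type*} [TopologicalSpace M]
  [ChartedSpace H M] [IsManifold I ∞ M]
  {E' : Type*} [NormedAddCommGroup E'] [NormedSpace ℝ E'] {H' : Type*} [TopologicalSpace H']
  {J : ModelWithCorners ℝ E' H'} {N : Type*} [TopologicalSpace N] [ChartedSpace H' N]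
  {i : N → Velocity I k M × Velocity I k M} {L : Velocity I (k + 1) M → ℝ} {t₀ t₁ : ℝ}
  {γ : ℝ → M}

lemma variation_eq_zero {δγ : (s : ℝ) → TangentSpace I (γ s)} {t : ℝ}
    (h : FieldContDiffAt ∞ γ δγ t) (h0 : ∀ᶠ s in 𝓝 t, δγ s = 0) :
    variation k γ δγ t = ⟨prolong I k γ t, 0⟩ := by
  rw [variation_eq (h.of_le ENat.LEInfty.out)]
  congr 1
  funext α
  exact iteratedDeriv_fieldCurve_eq_zero (contMDiffAt_totalSpace.1 h).1.continuousAt h0 α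

/-- The fundamental lemma of the calculus of variations, along a solution. -/
lemma IsSolution.forceCoeff_apply_eq_zero
    (hL : ContMDiff 𝓘(ℝ, Fin (k + 1 + 1) → E) 𝓘(ℝ, ℝ) ∞ L) (ht : t₀ < t₁)
    (hsol : IsSolution J i L t₀ t₁ γ) {δγ : (s : ℝ) → TangentSpace I (γ s)}
    (hδ : ∀ s ∈ Icc t₀ t₁, FieldContDiffAt ∞ γ δγ s) {t : ℝ} (htt : t ∈ Icc t₀ t₁) :
    forceCoeff L γ t (fieldCurve γ δγ t t) = 0 := by
  set F : ℝ → ℝ := fun s => ∑ j ∈ Finset.range (k + 1 + 1),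
    (-1) ^ j * iteratedDeriv j (weightedAction L γ δγ j) s with hF
  have hFc : ContinuousOn F (Icc t₀ t₁) := continuousOn_sum_weightedAction hL hδ
  have hFeq : ∀ s ∈ Icc t₀ t₁, forceCoeff L γ s (fieldCurve γ δγ s s) = F s :=
    fun s hs => forceCoeff_apply hL (hδ s hs)
  have hae : ∀ᵐ s, s ∈ Ioo t₀ t₁ → F s = 0 := by
    refine isOpen_Ioo.ae_eq_zero_of_integral_contDiff_smul_eq_zero
      ((hFc.mono Ioo_subset_Icc_self).locallyIntegrableOn measurableSet_Ioo)
      fun ψ hψ _ hsupp => ?_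
    have hη : ∀ s ∈ Icc t₀ t₁, FieldContDiffAt ∞ γ (fun r => ψ r • δγ r) s :=
      fun s hs => (hδ s hs).smul hψ.contDiffAt
    have hz : ∀ s ∉ Ioo t₀ t₁, ∀ᶠ r in 𝓝 s, ψ r • δγ r = 0 := fun s hs => by
      filter_upwards [(notMem_tsupport_iff_eventuallyEq.1 fun h => hs (hsupp h))] with r hr
      rw [hr, Pi.zero_apply, zero_smul]
    have hz₀ := hz t₀ (by simp)
    have hz₁ := hz t₁ (by simp)
    have h₀ := hη t₀ (left_mem_Icc.2 ht.le)
    have h₁ := hη t₁ (right_mem_Icc.2 ht.le)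
    have key := hsol.2 _ hη (by
      rw [variation_eq_zero h₀ hz₀, variation_eq_zero h₁ hz₁]
      exact zero_mem_tangentSet hsol.1)
    have e₀ := iteratedDeriv_fieldCurve_eq_zero
      (contMDiffAt_totalSpace.1 h₀).1.continuousAt hz₀
    have e₁ := iteratedDeriv_fieldCurve_eq_zero
      (contMDiffAt_totalSpace.1 h₁).1.continuousAt hz₁
    rw [actionDifferential_eq hL ht.le hη] at key
    simp only [e₀, e₁] at key
    rw [show (fun _ : Fin (k + 1) => (0 : E)) = 0 from rfl, map_zero, map_zero, add_zero,
      sub_zero] at key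
    rw [← intervalIntegral.integral_eq_integral_of_support_subset (a := t₀) (b := t₁), ← key]
    · refine intervalIntegral.integral_congr fun s hs => ?_
      rw [uIcc_of_le ht.le] at hs
      simp only [smul_eq_mul]
      rw [fieldCurve_smul (by simp), map_smul, smul_eq_mul, hFeq s hs]
    · intro s hs
      refine Ioo_subset_Ioc_self (hsupp (subset_tsupport _ fun h => hs ?_))
      simp [h]
  have hres : F =ᵐ[volume.restrict (Icc t₀ t₁)] 0 := by
    rw [Filter.EventuallyEq, ← restrict_Ioo_eq_restrict_Icc, ae_restrict_iff' measurableSet_Ioo]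
    exact hae
  rw [hFeq t htt]
  exact Measure.eqOn_Icc_of_ae_eq volume ht.ne hres hFc continuousOn_const htt

/-- Solutions satisfy the Euler–Lagrange equation. -/
lemma IsSolution.forceCoeff_eq_zero
    (hL : ContMDiff 𝓘(ℝ, Fin (k + 1 + 1) → E) 𝓘(ℝ, ℝ) ∞ L) (ht : t₀ < t₁)
    (hγ : ∀ t ∈ Icc t₀ t₁, ContMDiffAt 𝓘(ℝ, ℝ) I ∞ γ t)
    (hsol : IsSolution J i L t₀ t₁ γ) {t : ℝ} (htt : t ∈ Icc t₀ t₁) : forceCoeff L γ t = 0 := by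
  refine ContinuousLinearMap.ext fun e => ?_
  obtain ⟨δγ, h1, h2, -⟩ := exists_field_germ hγ htt (f := fun _ => e) contDiff_const univ_mem
  have h3 := hsol.forceCoeff_apply_eq_zero hL ht h1 htt
  rwa [h2.self_of_nhds] at h3

/-- Vector fields along a curve with prescribed jets at the end points. -/
lemma exists_field_jets (ht : t₀ < t₁)
    (hγ : ∀ t ∈ Icc t₀ t₁, ContMDiffAt 𝓘(ℝ, ℝ) I ∞ γ t) (v w : Fin (k + 1) → E) :
    ∃ δγ : (s : ℝ) → TangentSpace I (γ s), (∀ s ∈ Icc t₀ t₁, FieldContDiffAt ∞ γ δγ s) ∧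
      (∀ α : Fin (k + 1), iteratedDeriv α (fieldCurve γ δγ t₀) t₀ = v α) ∧
      ∀ α : Fin (k + 1), iteratedDeriv α (fieldCurve γ δγ t₁) t₁ = w α := by
  have m₀ : t₀ ∈ Icc t₀ t₁ := left_mem_Icc.2 ht.le
  have m₁ : t₁ ∈ Icc t₀ t₁ := right_mem_Icc.2 ht.le
  set c := (t₀ + t₁) / 2 with hc
  have hsm : ∀ (u : Fin (k + 1) → E) (t : ℝ), ContDiff ℝ ∞ fun s => jetPoly u (s - t) :=
    fun u t => (contDiff_jetPoly_right u).comp (contDiff_id.sub contDiff_const)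
  obtain ⟨δ, hδ, hδ₀, hδU⟩ := exists_field_germ hγ m₀ (hsm v t₀)
    (Iio_mem_nhds (show t₀ < c by linarith))
  obtain ⟨η, hη, hη₁, hηU⟩ := exists_field_germ hγ m₁ (hsm w t₁)
    (Ioi_mem_nhds (show c < t₁ by linarith))
  have hδ₁ : ∀ᶠ s in 𝓝 t₁, δ s = 0 := by
    filter_upwards [Ioi_mem_nhds (show c < t₁ by linarith)] with s hs
    exact hδU s fun h => lt_asymm (mem_Ioi.1 hs) (mem_Iio.1 h)
  have hη₀ : ∀ᶠ s in 𝓝 t₀, η s = 0 := by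
    filter_upwards [Iio_mem_nhds (show t₀ < c by linarith)] with s hs
    exact hηU s fun h => lt_asymm (mem_Iio.1 hs) (mem_Ioi.1 h)
  refine ⟨fun s => δ s + η s, fun s hs => (hδ s hs).add (hη s hs), fun α => ?_, fun α => ?_⟩
  · rw [← iteratedDeriv_jetPoly_sub v t₀ α]
    refine Filter.EventuallyEq.iteratedDeriv_eq _ ?_
    filter_upwards [hδ₀, fieldCurve_eventuallyEq_zero (hγ t₀ m₀).continuousAt hη₀,
      eventually_mem_source (I := I) (hγ t₀ m₀).continuousAt (x := γ t₀) (by simp)] with s h1 h2 h3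
    rw [fieldCurve_add h3, h1, h2, Pi.zero_apply, add_zero]
  · rw [← iteratedDeriv_jetPoly_sub w t₁ α]
    refine Filter.EventuallyEq.iteratedDeriv_eq _ ?_
    filter_upwards [hη₁, fieldCurve_eventuallyEq_zero (hγ t₁ m₁).continuousAt hδ₁,
      eventually_mem_source (I := I) (hγ t₁ m₁).continuousAt (x := γ t₁) (by simp)] with s h1 h2 h3
    rw [fieldCurve_add h3, h1, h2, Pi.zero_apply, zero_add]

end EulerLagrange

end HigherVelocity

end

theorem mainTheorem4
    {E : Type*} [NormedAddCommGroup E] [NormedSpace ℝ E] [FiniteDimensional ℝ E]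
    {H : Type*} [TopologicalSpace H] (I : ModelWithCorners ℝ E H) [I.Boundaryless]
    {M : Type*} [TopologicalSpace M] [ChartedSpace H M] [IsManifold I ∞ M]
    (k : ℕ)
    {E' : Type*} [NormedAddCommGroup E'] [NormedSpace ℝ E']
    {H' : Type*} [TopologicalSpace H'] (J : ModelWithCorners ℝ E' H')
    {N : Type*} [TopologicalSpace N] [ChartedSpace H' N] [IsManifold J ∞ N]
    (i : N → Velocity I k M × Velocity I k M)
    (hi : IsImmersion J (𝓘(ℝ, Fin (k + 1) → E).prod 𝓘(ℝ, Fin (k + 1) → E)) ∞ i)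
    (hinj : Function.Injective i)
    (L : Velocity I (k + 1) M → ℝ)
    (hL : ContMDiff 𝓘(ℝ, Fin (k + 1 + 1) → E) 𝓘(ℝ, ℝ) ∞ L)
    (t₀ t₁ : ℝ) (ht : t₀ < t₁)
    (γ : ℝ → M) (hγ : ∀ t ∈ Icc t₀ t₁, ContMDiffAt 𝓘(ℝ, ℝ) I ∞ γ t) :
    IsSolution J i L t₀ t₁ γ ↔
      (∀ t ∈ Icc t₀ t₁, force L γ t = ⟨γ t, 0⟩) ∧
      Annihilates J i
        (negCovector (dualFlip.symm (momentum L γ t₀)))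
        (dualFlip.symm (momentum L γ t₁)) := by
  have m₀ : t₀ ∈ Icc t₀ t₁ := left_mem_Icc.2 ht.le
  have m₁ : t₁ ∈ Icc t₀ t₁ := right_mem_Icc.2 ht.le
  have hvar : ∀ δγ : (t : ℝ) → TangentSpace I (γ t), ∀ t ∈ Icc t₀ t₁, FieldContDiffAt ∞ γ δγ t →
      variation k γ δγ t = ⟨prolong I k γ t, fun α => iteratedDeriv α (fieldCurve γ δγ t) t⟩ :=
    fun δγ t _ h => variation_eq (h.of_le ENat.LEInfty.out)
  simp only [force_eq_zero_iff, dualFlip_symm_momentum]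
  constructor
  · intro hsol
    have hF : ∀ t ∈ Icc t₀ t₁, forceCoeff L γ t = 0 :=
      fun t h => hsol.forceCoeff_eq_zero hL ht hγ h
    refine ⟨hF, hsol.1, fun v w hvw => ?_⟩
    obtain ⟨δγ, hδ, h₀, h₁⟩ := exists_field_jets ht hγ (k := k) v w
    have hT : (variation k γ δγ t₀, variation k γ δγ t₁) ∈ tangentSet J i := by
      rw [hvar δγ t₀ m₀ (hδ t₀ m₀), hvar δγ t₁ m₁ (hδ t₁ m₁), funext h₀, funext h₁]
      exact hvw
    have key := hsol.2 δγ hδ hT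
    rw [actionDifferential_eq hL ht.le hδ, funext h₀, funext h₁,
      intervalIntegral.integral_congr (g := fun _ => (0 : ℝ)) fun t h => ?_,
      intervalIntegral.integral_zero] at key
    · change -(momentumCoeff L γ t₀ v) + momentumCoeff L γ t₁ w = 0
      linarith
    · rw [uIcc_of_le ht.le] at h
      simp [hF t h]
  · rintro ⟨hF, hmem, hann⟩
    refine ⟨hmem, fun δγ hδ hT => ?_⟩
    rw [hvar δγ t₀ m₀ (hδ t₀ m₀), hvar δγ t₁ m₁ (hδ t₁ m₁)] at hT
    have key : -(momentumCoeff L γ t₀ fun α => iteratedDeriv α (fieldCurve γ δγ t₀) t₀)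
        + momentumCoeff L γ t₁ (fun α => iteratedDeriv α (fieldCurve γ δγ t₁) t₁) = 0 :=
      hann _ _ hT
    rw [actionDifferential_eq hL ht.le hδ,
      intervalIntegral.integral_congr (g := fun _ => (0 : ℝ)) fun t h => ?_,
      intervalIntegral.integral_zero]
    · linarith
    · rw [uIcc_of_le ht.le] at h
      simp [hF t h]
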